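/- Let $B_\bullet$ be the group of parenthesized braids, i.e. the group generated by $\sigma_i, a_i$ ($i\ge 1$) subject to the relations, for $i\ge 1$ and $j\ge i+2$, $$\sigma_i\sigma_j=\sigma_j\sigma_i,\quad \sigma_ia_j=a_j\sigma_i,\quad a_ia_{j-1}=a_ja_i,\quad a_i\sigma_{j-1}=\sigma_ja_i,$$ $$\sigma_i\sigma_{i+1}\sigma_i=\sigma_{i+1}\sigma_i\sigma_{i+1},\quad \sigma_{i+1}\sigma_ia_{i+1}=a_i\sigma_i,\quad \sigma_i\sigma_{i+1}a_i=a_{i+1}\sigma_i.$$ Let $\partial$ be the endomorphism of $B_\bullet$ with $\partial\sigma_i=\sigma_{i+1}$, $\partial a_i=a_{i+1}$, and put $x[y]=x\cdot\partial y\cdot\sigma_1\cdot(\partial x)^{-1}$ and $x\circ y=x\cdot\partial y\cdot a_1$. Call an element a special braid (resp. a special Thompson element, resp. a special parenthesized braid) if it belongs to the closure of $\{1\}$ under the bracket (resp. under $\circ$, resp. under both operations). Let $B_\bullet^+$ (the positive parenthesized braids) and $F^+$ (the positive Thompson elements) be the submonoids of $B_\bullet$ generated by all $\sigma_i$ and $a_i$,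 and by all $a_i$, respectively. Below, lengths $p,q,n$ are $\ge 0$, and an empty product is $1$. (i) Every $x\in B_\bullet^+$ has a unique decomposition $x=z_1\cdot\partial z_2\cdots\partial^{p-1}z_p$ with $z_1,\dots,z_p$ special parenthesized braids and $z_p\neq 1$ if $p\ge 1$. (ii) Every $x\in B_\bullet^+$ has a unique decomposition $x=\beta_1\cdot\partial\beta_2\cdots\partial^{n-1}\beta_n\cdot h_1\cdot\partial h_2\cdots\partial^{n-1}h_n$ with $\beta_1,\dots,\beta_n$ special braids, $h_1,\dots,h_n$ special Thompson elements, and $(\beta_n,h_n)\neq(1,1)$ if $n\ge 1$. (iii) Every $f\in F^+$ has a unique decomposition $f=h_1\cdot\partial h_2\cdots\partial^{p-1}h_p$ with $h_1,\dots,h_p$ special Thompson elements and $h_p\neq 1$ if $p\ge 1$. (iv) Every $x\in B_\bullet$ has a decomposition $$x=\partial^{q-1}z_q'^{-1}\cdots\partial z_2'^{-1}\cdot z_1'^{-1}\cdot z_1\cdot\partial z_2\cdots\partial^{p-1}z_p$$ with all $z_i,z'_i$ special parenthesized braids. (v) Every $x\in B_\bullet$ has a decomposition $$x=\partial^{n-1}h_n'^{-1}\cdots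 h_1'^{-1}\cdot\partial^{n-1}\beta_n'^{-1}\cdots\beta_1'^{-1}\cdot\beta_1\cdots\partial^{n-1}\beta_n\cdot h_1\cdots\partial^{n-1}h_n$$ with all $\beta_i,\beta'_i$ special braids and all $h_i,h'_i$ special Thompson elements. -/

import Mathlib

namespace ParenBraid

/-- Names of the generators. Indices start from `0`: `Gen.sigma i` and `Gen.a i` stand for the
generators usually written `σ_{i+1}` and `a_{i+1}`. -/
inductive Gen : Type
  | sigma (i : ℕ) : Gen
  | a (i : ℕ) : Gen

open Gen in
/-- `Rel u v` means that `u = v` is one of the defining relations of the group of parenthesized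
braids (seven families, for `i ≥ 0` and `j ≥ i + 2`; in the third and fourth families the usual
index `j - 1` is renamed `j`, so that the condition becomes `j ≥ i + 1`). -/
inductive Rel : FreeGroup Gen → FreeGroup Gen → Prop
  | sigma_sigma (i j : ℕ) (h : i + 2 ≤ j) :
      Rel (.of (sigma i) * .of (sigma j)) (.of (sigma j) * .of (sigma i))
  | sigma_a (i j : ℕ) (h : i + 2 ≤ j) :
      Rel (.of (sigma i) * .of (a j)) (.of (a j) * .of (sigma i))
  | a_a (i j : ℕ) (h : i + 1 ≤ j) :
      Rel (.of (a i) * .of (a j)) (.of (a (j + 1)) * .of (a i))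
  | a_sigma (i j : ℕ) (h : i + 1 ≤ j) :
      Rel (.of (a i) * .of (sigma j)) (.of (sigma (j + 1)) * .of (a i))
  | braid (i : ℕ) :
      Rel (.of (sigma i) * .of (sigma (i + 1)) * .of (sigma i))
        (.of (sigma (i + 1)) * .of (sigma i) * .of (sigma (i + 1)))
  | sigma_sigma_a (i : ℕ) :
      Rel (.of (sigma (i + 1)) * .of (sigma i) * .of (a (i + 1))) (.of (a i) * .of (sigma i))
  | sigma_sigma_a' (i : ℕ) :
      Rel (.of (sigma i) * .of (sigma (i + 1)) * .of (a i)) (.of (a (i + 1)) * .of (sigma i))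

/-- The relators `u * v⁻¹` of the defining relations `u = v`. -/
def rels : Set (FreeGroup Gen) := {r | ∃ u v, Rel u v ∧ r = u * v⁻¹}

/-- The group of parenthesized braids. -/
abbrev Braid : Type := PresentedGroup rels

/-- The generator usually written `σ_{i+1}`. -/
def σ (i : ℕ) : Braid := PresentedGroup.of (Gen.sigma i)

/-- The generator usually written `a_{i+1}`. -/
def a (i : ℕ) : Braid := PresentedGroup.of (Gen.a i)

/-- The index shift on generators. -/
def Gen.succ : Gen → Gen
  | .sigma i => .sigma (i + 1)
  | .a i => .a (i + 1)

theorem Rel.succ {u v : FreeGroup Gen} (h : Rel u v) :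
    Rel (FreeGroup.map Gen.succ u) (FreeGroup.map Gen.succ v) := by
  cases h <;> simp only [map_mul, FreeGroup.map.of, Gen.succ]
  · exact .sigma_sigma _ _ (by omega)
  · exact .sigma_a _ _ (by omega)
  · exact .a_a _ _ (by omega)
  · exact .a_sigma _ _ (by omega)
  · exact .braid _
  · exact .sigma_sigma_a _
  · exact .sigma_sigma_a' _

theorem lift_shift_rels (r : FreeGroup Gen) (hr : r ∈ rels) :
    FreeGroup.lift (fun g => (PresentedGroup.of g.succ : Braid)) r = 1 := by
  obtain ⟨u, v, h, rfl⟩ := hr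
  have e : FreeGroup.lift (fun g => (PresentedGroup.of g.succ : Braid)) =
      (PresentedGroup.mk rels).comp (FreeGroup.map Gen.succ) := by
    ext g
    simp [PresentedGroup.of]
  rw [e, MonoidHom.comp_apply]
  exact PresentedGroup.one_of_mem ⟨_, _, h.succ, by simp⟩

/-- The shift endomorphism `∂`: it maps each `σ i` to `σ (i + 1)` and each `a i` to
`a (i + 1)`. -/
def shift : Braid →* Braid :=
  PresentedGroup.toGroup (f := fun g => (PresentedGroup.of g.succ : Braid)) lift_shift_rels

theorem shift_σ (i : ℕ) : shift (σ i) = σ (i + 1) :=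
  PresentedGroup.toGroup.of lift_shift_rels

theorem shift_a (i : ℕ) : shift (a i) = a (i + 1) :=
  PresentedGroup.toGroup.of lift_shift_rels

/-- The bracket `x[y] = x · ∂y · σ₁ · ∂x⁻¹`. -/
def bracket (x y : Braid) : Braid := x * shift y * σ 0 * (shift x)⁻¹

/-- The second operation `x ∘ y = x · ∂y · a₁`. -/
def circ (x y : Braid) : Braid := x * shift y * a 0

/-- Special braids: the closure of `{1}` under the bracket. -/
inductive IsSpecialBraid : Braid → Prop
  | one : IsSpecialBraid 1
  | bracket {x y : Braid} : IsSpecialBraid x → IsSpecialBraid y → IsSpecialBraid (bracket x y)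

/-- Special Thompson elements: the closure of `{1}` under `∘`. -/
inductive IsSpecialThompson : Braid → Prop
  | one : IsSpecialThompson 1
  | circ {x y : Braid} :
      IsSpecialThompson x → IsSpecialThompson y → IsSpecialThompson (circ x y)

/-- Special parenthesized braids: the closure of `{1}` under the bracket and `∘`. -/
inductive IsSpecial : Braid → Prop
  | one : IsSpecial 1
  | bracket {x y : Braid} : IsSpecial x → IsSpecial y → IsSpecial (bracket x y)
  | circ {x y : Braid} : IsSpecial x → IsSpecial y → IsSpecial (circ x y)

/-- Positive parenthesized braids: those represented by a word without inverses of generators. -/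
def positive : Submonoid Braid := Submonoid.closure (Set.range σ ∪ Set.range a)

/-- Positive Thompson elements: those represented by a word in the letters `a i`, without
inverses. -/
def positiveThompson : Submonoid Braid := Submonoid.closure (Set.range a)

/-- The shifted product `z₁ · ∂z₂ · ∂²z₃ ⋯ ∂^{p-1}z_p` of a list `[z₁, …, z_p]`. -/
def shiftedProd (l : List Braid) : Braid := (l.mapIdx fun i z => shift^[i] z).prod

end ParenBraid

namespace ParenBraid

/-! ### Relations in the group and the shift -/

/-! Existence rests on absorption: `x · ∂y · ∂²m · σ₁ = x[y] · ∂x · ∂²m` and `x · ∂y · ∂²m · a₁ = (x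
∘ y) · ∂m`, so shifted products of special elements are stable under right multiplication by
positive generators. Exchanging `a` and `σ` letters writes a positive element as a positive braid
times a positive Thompson element. For fractions, braids have common left multiples because every
generator divides a central full twist, Thompson elements have them by the relations `a_i a_{j-1} =
a_j a_i`, and the exchange relations carry Thompson denominators across braids.

Uniqueness separates Thompson data from braid data. The bracket and `∘` satisfy distributivity laws
that push brackets down to leaves, so a special parenthesized braid is a binary tree of special
braids (`IsSpecial.exists_tree`), and a shifted product of trees is the shifted product of all the
leaves times that of the shapes (`Tree.shiftedProd_map_eval`). The group acts on sequences of
colors. With a trivial bracket and functions on the Cantor space as colors, braids fix constant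
sequences while the shapes can be read off (`shape_unique`).

It remains to recover a list of special braids (`braid_unique`). Two special braids `y`, `z` are
equal, or `y⁻¹z` or `z⁻¹y` is σ₁-positive: by confluence of self-distributive expansion, any two
terms in one variable expand to terms of which one is an iterated left subterm of the other
(`Term.exists_leftSub`). A σ₁-positive braid is never a shift, as the first letters of reduced words
under the Artin action on a free group show (`IsSigmaPositive.shift_ne`). Uniqueness is proved for
lists of equal length and then transferred to trimmed lists by padding with `1`. -/

theorem mk_eq_of_rel {u v : FreeGroup Gen} (h : Rel u v) :
    PresentedGroup.mk rels u = PresentedGroup.mk rels v := by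
  have := PresentedGroup.one_of_mem (rels := rels) ⟨u, v, h, rfl⟩
  rwa [map_mul, map_inv, mul_inv_eq_one] at this

theorem σ_mul_σ {i j : ℕ} (h : i + 2 ≤ j) : σ i * σ j = σ j * σ i :=
  mk_eq_of_rel (.sigma_sigma i j h)

theorem σ_mul_a {i j : ℕ} (h : i + 2 ≤ j) : σ i * a j = a j * σ i :=
  mk_eq_of_rel (.sigma_a i j h)

theorem a_mul_a {i j : ℕ} (h : i + 1 ≤ j) : a i * a j = a (j + 1) * a i :=
  mk_eq_of_rel (.a_a i j h)

theorem a_mul_σ {i j : ℕ} (h : i + 1 ≤ j) : a i * σ j = σ (j + 1) * a i :=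
  mk_eq_of_rel (.a_sigma i j h)

theorem σ_braid (i : ℕ) : σ i * σ (i + 1) * σ i = σ (i + 1) * σ i * σ (i + 1) :=
  mk_eq_of_rel (.braid i)

theorem σ_succ_mul_σ_mul_a (i : ℕ) : σ (i + 1) * σ i * a (i + 1) = a i * σ i :=
  mk_eq_of_rel (.sigma_sigma_a i)

theorem σ_mul_σ_succ_mul_a (i : ℕ) : σ i * σ (i + 1) * a i = a (i + 1) * σ i :=
  mk_eq_of_rel (.sigma_sigma_a' i)

theorem hom_ext {H : Type*} [Group H] {f g : Braid →* H} (hσ : ∀ i, f (σ i) = g (σ i))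
    (ha : ∀ i, f (a i) = g (a i)) : f = g :=
  PresentedGroup.ext (rels := rels) fun x => by
    cases x with
    | sigma i => exact hσ i
    | a i => exact ha i

/-- Conjugation by `σ 0` composed with `∂²` is an endomorphism, so it is enough to compare
generators, where the far commutation relations apply. -/
theorem σ_zero_mul_shift_shift (x : Braid) :
    σ 0 * shift (shift x) = shift (shift x) * σ 0 := by
  have : ((MulAut.conj (σ 0)).toMonoidHom.comp (shift.comp shift)) = shift.comp shift := by
    refine hom_ext (fun i => ?_) (fun i => ?_)
    · simp [shift_σ, σ_mul_σ (i := 0) (j := i + 2) (by omega)]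
    · simp [shift_a, σ_mul_a (i := 0) (j := i + 2) (by omega)]
  have := DFunLike.congr_fun this x
  simpa [mul_inv_eq_iff_eq_mul] using this

theorem a_zero_mul_shift (x : Braid) : a 0 * shift x = shift (shift x) * a 0 := by
  have : ((MulAut.conj (a 0)).toMonoidHom.comp shift) = shift.comp shift := by
    refine hom_ext (fun i => ?_) (fun i => ?_)
    · simp [shift_σ, a_mul_σ (i := 0) (j := i + 1) (by omega)]
    · simp [shift_a, a_mul_a (i := 0) (j := i + 1) (by omega)]
  have := DFunLike.congr_fun this x
  simpa [mul_inv_eq_iff_eq_mul] using this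

/-- Left self-distributivity is the braid relation `σ₁σ₂σ₁ = σ₂σ₁σ₂`, once the factors in the image
of `∂²` are moved past `σ₁`. -/
theorem bracket_bracket (x y z : Braid) :
    bracket x (bracket y z) = bracket (bracket x y) (bracket x z) := by
  have h1 := σ_zero_mul_shift_shift y⁻¹
  have h2 := σ_zero_mul_shift_shift z
  have h3 := σ_zero_mul_shift_shift x
  have h4 := σ_braid 0
  simp only [map_inv] at h1
  simp only [bracket, map_mul, map_inv, shift_σ, mul_inv_rev, inv_inv]
  calc x * (shift y * shift (shift z) * σ (0 + 1) * (shift (shift y))⁻¹) * σ 0 * (shift x)⁻¹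
      = x * shift y * shift (shift z) * σ (0 + 1) * ((shift (shift y))⁻¹ * σ 0) * (shift x)⁻¹ := by
        group
    _ = x * shift y * shift (shift z) * (σ (0 + 1) * σ 0 * σ (0 + 1)) * (σ (0 + 1))⁻¹
          * (shift (shift y))⁻¹ * (shift x)⁻¹ := by rw [← h1]; group
    _ = x * shift y * (shift (shift z) * σ 0) * σ (0 + 1) * σ 0 * (σ (0 + 1))⁻¹
          * (shift (shift y))⁻¹ * (shift x)⁻¹ := by rw [← h4]; group
    _ = x * shift y * σ 0 * shift (shift z) * σ (0 + 1) * (shift (shift x))⁻¹ *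
          (shift (shift x) * σ 0) * (σ (0 + 1))⁻¹ * (shift (shift y))⁻¹ * (shift x)⁻¹ := by
        rw [← h2]; group
    _ = _ := by rw [← h3]; group

/-- This law and the next express the two relations mixing `a` with two adjacent `σ`. Together they
let a bracket of trees be computed leaf by leaf. -/
theorem bracket_circ (x y z : Braid) :
    bracket x (circ y z) = circ (bracket x y) (bracket x z) := by
  have h1 := a_zero_mul_shift x⁻¹
  have h2 := σ_zero_mul_shift_shift z
  have h3 := σ_mul_σ_succ_mul_a 0
  simp only [map_inv] at h1
  simp only [bracket, circ, map_mul, map_inv, shift_σ, shift_a]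
  calc x * (shift y * shift (shift z) * a (0 + 1)) * σ 0 * (shift x)⁻¹
      = x * shift y * shift (shift z) * (a (0 + 1) * σ 0) * (shift x)⁻¹ := by group
    _ = x * shift y * (shift (shift z) * σ 0) * σ (0 + 1) * (a 0 * (shift x)⁻¹) := by
        rw [← h3]; group
    _ = _ := by rw [← h2, h1]; group

theorem circ_bracket (x y z : Braid) :
    bracket (circ x y) z = bracket x (bracket y z) := by
  have h1 := a_zero_mul_shift z
  have h2 := σ_zero_mul_shift_shift y⁻¹
  have h3 := σ_succ_mul_σ_mul_a 0
  simp only [map_inv] at h2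
  simp only [bracket, circ, map_mul, map_inv, shift_σ, shift_a, mul_inv_rev]
  calc x * shift y * a 0 * shift z * σ 0 *
        ((a (0 + 1))⁻¹ * ((shift (shift y))⁻¹ * (shift x)⁻¹))
      = x * shift y * (a 0 * shift z) * σ 0 * (a (0 + 1))⁻¹ * (shift (shift y))⁻¹ * (shift x)⁻¹ := by
        group
    _ = x * shift y * shift (shift z) * (a 0 * σ 0) * (a (0 + 1))⁻¹ * (shift (shift y))⁻¹
          * (shift x)⁻¹ := by rw [h1]; group
    _ = x * shift y * shift (shift z) * σ (0 + 1) * (σ 0 * (shift (shift y))⁻¹)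
          * (shift x)⁻¹ := by rw [← h3]; group
    _ = _ := by rw [h2]; group

/-! ### Shifted products -/

@[simp] theorem shiftedProd_nil : shiftedProd [] = 1 := rfl

@[simp] theorem shiftedProd_cons (z : Braid) (l : List Braid) :
    shiftedProd (z :: l) = z * shift (shiftedProd l) := by
  have : l.mapIdx (fun i z => shift^[i + 1] z) =
      (l.mapIdx fun i z => shift^[i] z).map shift := by
    apply List.ext_getElem
    · simp
    · simp [-Function.iterate_succ, Function.iterate_succ_apply']
  simp only [shiftedProd, List.mapIdx_cons, List.prod_cons, map_list_prod, this,
    Function.iterate_zero, id]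

theorem shiftedProd_append (l l' : List Braid) :
    shiftedProd (l ++ l') = shiftedProd l * shift^[l.length] (shiftedProd l') := by
  induction l with
  | nil => simp
  | cons z l ih => simp [ih, mul_assoc, Function.iterate_succ_apply']

theorem shiftedProd_replicate (n : ℕ) : shiftedProd (List.replicate n 1) = 1 := by
  induction n with
  | zero => rfl
  | succ n ih => simp [List.replicate_succ, ih]

theorem shiftedProd_append_replicate (l : List Braid) (n : ℕ) :
    shiftedProd (l ++ List.replicate n 1) = shiftedProd l := by
  simp [shiftedProd_append, shiftedProd_replicate]

/-- For `i = 0`, the letter slides left past the entries from the third on, and `x · ∂y · σ₁ = x[y]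
· ∂x`. For larger `i` the letter goes into the tail. Padding with `1` supplies missing entries. -/
theorem exists_shiftedProd_mul_σ {p : Braid → Prop} (h1 : p 1)
    (hb : ∀ x y, p x → p y → p (bracket x y)) (i : ℕ) (l : List Braid) (hl : ∀ z ∈ l, p z) :
    ∃ l' : List Braid, (∀ z ∈ l', p z) ∧ shiftedProd l' = shiftedProd l * σ i := by
  induction i generalizing l with
  | zero =>
    obtain ⟨x, y, m, hx, hy, hm, e⟩ : ∃ x y m, p x ∧ p y ∧ (∀ z ∈ m, p z) ∧
        shiftedProd l = shiftedProd (x :: y :: m) := by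
      match l, hl with
      | [], _ => exact ⟨1, 1, [], h1, h1, by simp, by simp⟩
      | [x], hl => exact ⟨x, 1, [], hl x (by simp), h1, by simp, by simp⟩
      | x :: y :: m, hl =>
        exact ⟨x, y, m, hl x (by simp), hl y (by simp), fun z hz => hl z (by simp [hz]), rfl⟩
    refine ⟨bracket x y :: x :: m, by simpa using ⟨hb x y hx hy, hx, hm⟩, ?_⟩
    rw [e]
    simp only [shiftedProd_cons, map_mul, bracket, mul_assoc, inv_mul_cancel_left]
    rw [σ_zero_mul_shift_shift]
  | succ i ih =>
    obtain ⟨x, m, hx, hm, e⟩ : ∃ x m, p x ∧ (∀ z ∈ m, p z) ∧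
        shiftedProd l = shiftedProd (x :: m) := by
      match l, hl with
      | [], _ => exact ⟨1, [], h1, by simp, by simp⟩
      | x :: m, hl => exact ⟨x, m, hl x (by simp), fun z hz => hl z (by simp [hz]), rfl⟩
    obtain ⟨m', hm', e'⟩ := ih m hm
    refine ⟨x :: m', by simpa using ⟨hx, hm'⟩, ?_⟩
    simp [e, e', shift_σ, mul_assoc]

/-- Here the first two entries merge into `x ∘ y`, and moving `a₁` left across `∂²m` lowers it to
`∂m`. -/
theorem exists_shiftedProd_mul_a {p : Braid → Prop} (h1 : p 1)
    (hc : ∀ x y, p x → p y → p (circ x y)) (i : ℕ) (l : List Braid) (hl : ∀ z ∈ l, p z) :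
    ∃ l' : List Braid, (∀ z ∈ l', p z) ∧ shiftedProd l' = shiftedProd l * a i := by
  induction i generalizing l with
  | zero =>
    obtain ⟨x, y, m, hx, hy, hm, e⟩ : ∃ x y m, p x ∧ p y ∧ (∀ z ∈ m, p z) ∧
        shiftedProd l = shiftedProd (x :: y :: m) := by
      match l, hl with
      | [], _ => exact ⟨1, 1, [], h1, h1, by simp, by simp⟩
      | [x], hl => exact ⟨x, 1, [], hl x (by simp), h1, by simp, by simp⟩
      | x :: y :: m, hl =>
        exact ⟨x, y, m, hl x (by simp), hl y (by simp), fun z hz => hl z (by simp [hz]), rfl⟩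
    refine ⟨circ x y :: m, by simpa using ⟨hc x y hx hy, hm⟩, ?_⟩
    rw [e]
    simp only [shiftedProd_cons, map_mul, circ, mul_assoc]
    rw [a_zero_mul_shift]
  | succ i ih =>
    obtain ⟨x, m, hx, hm, e⟩ : ∃ x m, p x ∧ (∀ z ∈ m, p z) ∧
        shiftedProd l = shiftedProd (x :: m) := by
      match l, hl with
      | [], _ => exact ⟨1, [], h1, by simp, by simp⟩
      | x :: m, hl => exact ⟨x, m, hl x (by simp), fun z hz => hl z (by simp [hz]), rfl⟩
    obtain ⟨m', hm', e'⟩ := ih m hm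
    refine ⟨x :: m', by simpa using ⟨hx, hm'⟩, ?_⟩
    simp [e, e', shift_a, mul_assoc]

/-- The positive braids, without the generators `a i`. -/
def positiveBraid : Submonoid Braid := Submonoid.closure (Set.range σ)

/-- The subgroup generated by the `σ i`. -/
def braidSubgroup : Subgroup Braid := Subgroup.closure (Set.range σ)

theorem exists_shiftedProd_of_mem_positive {x : Braid} (hx : x ∈ positive) :
    ∃ l : List Braid, (∀ z ∈ l, IsSpecial z) ∧ x = shiftedProd l := by
  induction hx using Submonoid.closure_induction_right with
  | one => exact ⟨[], by simp, rfl⟩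
  | mul_right x _ y hy ih =>
    obtain ⟨l, hl, rfl⟩ := ih
    rcases hy with ⟨i, rfl⟩ | ⟨i, rfl⟩
    · obtain ⟨l', h, e⟩ := exists_shiftedProd_mul_σ .one (fun _ _ => .bracket) i l hl
      exact ⟨l', h, e.symm⟩
    · obtain ⟨l', h, e⟩ := exists_shiftedProd_mul_a .one (fun _ _ => .circ) i l hl
      exact ⟨l', h, e.symm⟩

theorem exists_shiftedProd_of_mem_positiveBraid {x : Braid} (hx : x ∈ positiveBraid) :
    ∃ l : List Braid, (∀ z ∈ l, IsSpecialBraid z) ∧ x = shiftedProd l := by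
  induction hx using Submonoid.closure_induction_right with
  | one => exact ⟨[], by simp, rfl⟩
  | mul_right x _ y hy ih =>
    obtain ⟨l, hl, rfl⟩ := ih
    obtain ⟨i, rfl⟩ := hy
    obtain ⟨l', h, e⟩ := exists_shiftedProd_mul_σ .one (fun _ _ => .bracket) i l hl
    exact ⟨l', h, e.symm⟩

theorem exists_shiftedProd_of_mem_positiveThompson {x : Braid} (hx : x ∈ positiveThompson) :
    ∃ l : List Braid, (∀ z ∈ l, IsSpecialThompson z) ∧ x = shiftedProd l := by
  induction hx using Submonoid.closure_induction_right with
  | one => exact ⟨[], by simp, rfl⟩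
  | mul_right x _ y hy ih =>
    obtain ⟨l, hl, rfl⟩ := ih
    obtain ⟨i, rfl⟩ := hy
    obtain ⟨l', h, e⟩ := exists_shiftedProd_mul_a .one (fun _ _ => .circ) i l hl
    exact ⟨l', h, e.symm⟩

theorem σ_mem_positiveBraid (i : ℕ) : σ i ∈ positiveBraid :=
  Submonoid.subset_closure ⟨i, rfl⟩

theorem a_mem_positiveThompson (i : ℕ) : a i ∈ positiveThompson :=
  Submonoid.subset_closure ⟨i, rfl⟩

theorem σ_mem_braidSubgroup (i : ℕ) : σ i ∈ braidSubgroup :=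
  Subgroup.subset_closure ⟨i, rfl⟩

theorem positiveBraid_le : positiveBraid ≤ positive :=
  Submonoid.closure_mono Set.subset_union_left

theorem positiveThompson_le : positiveThompson ≤ positive :=
  Submonoid.closure_mono Set.subset_union_right

theorem mem_braidSubgroup_of_mem_positiveBraid {x : Braid} (hx : x ∈ positiveBraid) :
    x ∈ braidSubgroup :=
  (Submonoid.closure_le (S := braidSubgroup.toSubmonoid)).2 Subgroup.subset_closure hx

theorem shift_mem_braidSubgroup {x : Braid} (hx : x ∈ braidSubgroup) :
    shift x ∈ braidSubgroup := by
  have : braidSubgroup ≤ braidSubgroup.comap shift := by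
    refine (Subgroup.closure_le _).2 ?_
    rintro _ ⟨i, rfl⟩
    simpa [shift_σ] using σ_mem_braidSubgroup (i + 1)
  exact this hx

theorem IsSpecialBraid.mem_braidSubgroup {x : Braid} (hx : IsSpecialBraid x) :
    x ∈ braidSubgroup := by
  induction hx with
  | one => exact one_mem _
  | bracket _ _ hx hy =>
    exact mul_mem (mul_mem (mul_mem hx (shift_mem_braidSubgroup hy)) (σ_mem_braidSubgroup 0))
      (inv_mem (shift_mem_braidSubgroup hx))

theorem shiftedProd_mem_braidSubgroup {l : List Braid} (hl : ∀ z ∈ l, z ∈ braidSubgroup) :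
    shiftedProd l ∈ braidSubgroup := by
  induction l with
  | nil => exact one_mem _
  | cons z l ih =>
    rw [shiftedProd_cons]
    exact mul_mem (hl z (by simp)) (shift_mem_braidSubgroup (ih fun z hz => hl z (by simp [hz])))

/-! ### Moving Thompson elements across braids -/

/-- Generators can be exchanged: `a k * σ i = w * a j` where `w` is a positive braid. -/
theorem exists_σ_mul_a (i j : ℕ) : ∃ k, ∃ w ∈ positiveBraid, a k * σ i = w * a j := by
  rcases lt_trichotomy j i with h | rfl | h
  · exact ⟨j, _, σ_mem_positiveBraid (i + 1), a_mul_σ h⟩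
  · exact ⟨j + 1, _, mul_mem (σ_mem_positiveBraid j) (σ_mem_positiveBraid (j + 1)),
      (σ_mul_σ_succ_mul_a j).symm⟩
  · obtain rfl | h := (Nat.succ_le_of_lt h).eq_or_lt
    · exact ⟨i, _, mul_mem (σ_mem_positiveBraid (i + 1)) (σ_mem_positiveBraid i),
        (σ_succ_mul_σ_mul_a i).symm⟩
    · exact ⟨j, _, σ_mem_positiveBraid i, (σ_mul_a h).symm⟩

/-- The same relations with the left index given. Having both directions allows exchanges with `(σ
i)⁻¹` as well. -/
theorem exists_a_mul_σ (i k : ℕ) : ∃ j, ∃ w ∈ positiveBraid, a k * σ i = w * a j := by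
  rcases lt_trichotomy k i with h | rfl | h
  · exact ⟨k, _, σ_mem_positiveBraid (i + 1), a_mul_σ h⟩
  · exact ⟨k + 1, _, mul_mem (σ_mem_positiveBraid (k + 1)) (σ_mem_positiveBraid k),
      (σ_succ_mul_σ_mul_a k).symm⟩
  · obtain rfl | h := (Nat.succ_le_of_lt h).eq_or_lt
    · exact ⟨i, _, mul_mem (σ_mem_positiveBraid i) (σ_mem_positiveBraid (i + 1)),
        (σ_mul_σ_succ_mul_a i).symm⟩
    · exact ⟨k, _, σ_mem_positiveBraid i, (σ_mul_a h).symm⟩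

theorem exists_thompson_mul_σ {h : Braid} (hh : h ∈ positiveThompson) (i : ℕ) :
    ∃ w ∈ positiveBraid, ∃ h' ∈ positiveThompson, h * σ i = w * h' := by
  have key : ∀ h ∈ positiveThompson, ∀ w ∈ positiveBraid,
      ∃ w' ∈ positiveBraid, ∃ h' ∈ positiveThompson, h * w = w' * h' := by
    intro h hh
    induction hh using Submonoid.closure_induction_left with
    | one => exact fun w hw => ⟨w, hw, 1, one_mem _, by simp⟩
    | mul_left x hx h hh ih =>
      obtain ⟨k, rfl⟩ := hx
      have : ∀ w ∈ positiveBraid, ∀ k, ∃ w' ∈ positiveBraid, ∃ j, a k * w = w' * a j := by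
        intro w hw
        induction hw using Submonoid.closure_induction_left with
        | one => exact fun k => ⟨1, one_mem _, k, by simp⟩
        | mul_left y hy w hw ih =>
          obtain ⟨i, rfl⟩ := hy
          intro k
          obtain ⟨j, v, hv, e⟩ := exists_a_mul_σ i k
          obtain ⟨w', hw', j', e'⟩ := ih j
          exact ⟨v * w', mul_mem hv hw', j', by rw [← mul_assoc, e, mul_assoc, e', mul_assoc]⟩
      intro w hw
      obtain ⟨w', hw', h', hh', e⟩ := ih w hw
      obtain ⟨w'', hw'', j, e'⟩ := this w' hw' k
      exact ⟨w'', hw'', a j * h', mul_mem (a_mem_positiveThompson j) hh', by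
        rw [mul_assoc, e, ← mul_assoc, e', mul_assoc]⟩
  exact key h hh _ (σ_mem_positiveBraid i)

theorem exists_thompson_mul_σ_inv {h : Braid} (hh : h ∈ positiveThompson) (i : ℕ) :
    ∃ h' ∈ positiveThompson, ∃ w ∈ braidSubgroup, h * (σ i)⁻¹ = w * h' := by
  suffices ∀ γ ∈ braidSubgroup, ∃ h' ∈ positiveThompson, ∃ w ∈ braidSubgroup,
      h * γ = w * h' from this _ (inv_mem (σ_mem_braidSubgroup i))
  have one : ∀ γ ∈ braidSubgroup, ∀ k, ∃ j, ∃ w ∈ braidSubgroup, a k * γ = w * a j := by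
    intro γ hγ
    induction hγ using Subgroup.closure_induction_left with
    | one => exact fun k => ⟨k, 1, one_mem _, by simp⟩
    | mul_left y hy γ _ ih =>
      obtain ⟨i, rfl⟩ := hy
      intro k
      obtain ⟨j, w, hw, e⟩ := exists_a_mul_σ i k
      obtain ⟨l, w', hw', e'⟩ := ih j
      exact ⟨l, w * w', mul_mem (mem_braidSubgroup_of_mem_positiveBraid hw) hw', by
        rw [← mul_assoc, e, mul_assoc, e', mul_assoc]⟩
    | inv_mul_cancel y hy γ _ ih =>
      obtain ⟨i, rfl⟩ := hy
      intro k
      -- The relation `a j * σ i = w * a k` read backwards gives `a k * (σ i)⁻¹ = w⁻¹ * a j`.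
      obtain ⟨j, w, hw, e⟩ := exists_σ_mul_a i k
      obtain ⟨l, w', hw', e'⟩ := ih j
      refine ⟨l, w⁻¹ * w', mul_mem (inv_mem (mem_braidSubgroup_of_mem_positiveBraid hw)) hw', ?_⟩
      rw [mul_assoc, ← e', eq_inv_mul_iff_mul_eq, ← mul_assoc, ← mul_assoc, ← e]
      simp
  induction hh using Submonoid.closure_induction_left with
  | one => exact fun γ hγ => ⟨1, one_mem _, γ, hγ, by simp⟩
  | mul_left y hy h _ ih =>
    obtain ⟨k, rfl⟩ := hy
    intro γ hγ
    obtain ⟨h', hh', w, hw, e⟩ := ih γ hγ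
    obtain ⟨j, w', hw', e'⟩ := one w hw k
    exact ⟨a j * h', mul_mem (a_mem_positiveThompson j) hh', w', hw', by
      rw [mul_assoc, e, ← mul_assoc, e', mul_assoc]⟩

theorem exists_mul_of_mem_positive {x : Braid} (hx : x ∈ positive) :
    ∃ w ∈ positiveBraid, ∃ h ∈ positiveThompson, x = w * h := by
  induction hx using Submonoid.closure_induction_right with
  | one => exact ⟨1, one_mem _, 1, one_mem _, by simp⟩
  | mul_right x _ y hy ih =>
    obtain ⟨w, hw, h, hh, rfl⟩ := ih
    rcases hy with ⟨i, rfl⟩ | ⟨i, rfl⟩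
    · obtain ⟨w', hw', h', hh', e⟩ := exists_thompson_mul_σ hh i
      exact ⟨w * w', mul_mem hw hw', h', hh', by rw [mul_assoc, e, mul_assoc]⟩
    · exact ⟨w, hw, h * a i, mul_mem hh (a_mem_positiveThompson i), by rw [mul_assoc]⟩

/-- Equivalently `γ c⁻¹ = c'⁻¹ γ'`: a Thompson denominator moves to the left of a braid. -/
theorem exists_thompson_mul_braid_mul_inv {c γ : Braid} (hc : c ∈ positiveThompson)
    (hγ : γ ∈ braidSubgroup) :
    ∃ c' ∈ positiveThompson, ∃ γ' ∈ braidSubgroup, c' * γ = γ' * c := by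
  have one : ∀ γ ∈ braidSubgroup, ∀ j, ∃ k, ∃ γ' ∈ braidSubgroup, a k * γ = γ' * a j := by
    intro γ hγ
    induction hγ using Subgroup.closure_induction_right with
    | one => exact fun j => ⟨j, 1, one_mem _, by simp⟩
    | mul_right γ _ y hy ih =>
      obtain ⟨i, rfl⟩ := hy
      intro j
      obtain ⟨k, w, hw, e⟩ := exists_σ_mul_a i j
      obtain ⟨l, γ', hγ', e'⟩ := ih k
      exact ⟨l, γ' * w, mul_mem hγ' (mem_braidSubgroup_of_mem_positiveBraid hw), by
        rw [← mul_assoc, e', mul_assoc, e, mul_assoc]⟩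
    | mul_inv_cancel γ _ y hy ih =>
      obtain ⟨i, rfl⟩ := hy
      intro j
      obtain ⟨k, w, hw, e⟩ := exists_a_mul_σ i j
      obtain ⟨l, γ', hγ', e'⟩ := ih k
      refine ⟨l, γ' * w⁻¹,
        mul_mem hγ' (inv_mem (mem_braidSubgroup_of_mem_positiveBraid hw)), ?_⟩
      rw [← mul_assoc, e', mul_inv_eq_iff_eq_mul, mul_assoc, mul_assoc, e]
      simp
  induction hc using Submonoid.closure_induction_right generalizing γ with
  | one => exact ⟨1, one_mem _, γ, hγ, by simp⟩
  | mul_right c _ y hy ih =>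
    obtain ⟨j, rfl⟩ := hy
    obtain ⟨k, γ', hγ', e⟩ := one γ hγ j
    obtain ⟨c', hc', γ'', hγ'', e'⟩ := ih hγ'
    exact ⟨c' * a k, mul_mem hc' (a_mem_positiveThompson k), γ'', hγ'', by
      rw [mul_assoc, e, ← mul_assoc, e', mul_assoc]⟩

/-! ### Left common multiples and fractions -/

/-- The braid `σ 0 * σ 1 * ⋯ * σ (n - 1)`. -/
def rot : ℕ → Braid
  | 0 => 1
  | n + 1 => rot n * σ n

theorem rot_mem (n : ℕ) : rot n ∈ positiveBraid := by
  induction n with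
  | zero => exact one_mem _
  | succ n ih => exact mul_mem ih (σ_mem_positiveBraid n)

theorem rot_mul_σ_of_lt {n i : ℕ} (h : n < i) : rot n * σ i = σ i * rot n := by
  induction n with
  | zero => simp [rot]
  | succ n ih =>
    rw [rot, mul_assoc, σ_mul_σ (by omega), ← mul_assoc, ih (by omega), mul_assoc]

theorem rot_mul_σ {n i : ℕ} (h : i + 1 < n) : rot n * σ i = σ (i + 1) * rot n := by
  induction n with
  | zero => omega
  | succ n ih =>
    obtain rfl | h' := (Nat.lt_succ_iff.1 h).eq_or_lt
    · simp only [rot]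
      rw [mul_assoc (rot i), mul_assoc (rot i), σ_braid, ← mul_assoc, ← mul_assoc,
        rot_mul_σ_of_lt (by omega)]
      simp only [mul_assoc]
    · rw [rot, mul_assoc, ← σ_mul_σ (by omega), ← mul_assoc, ih h', mul_assoc]

/-- Conjugation by `rot` raises indices by one until the last generator; two further conjugations
bring it back to `σ 0`, closing the cycle. -/
theorem rot_mul_rot_mul_σ (n : ℕ) :
    rot (n + 1) * rot (n + 1) * σ n = σ 0 * (rot (n + 1) * rot (n + 1)) := by
  induction n with
  | zero => simp [rot, mul_assoc]
  | succ n ih =>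
    have h1 : rot (n + 2) * rot (n + 2) =
        rot (n + 1) * rot (n + 1) * σ (n + 1) * σ n := by
      have : rot (n + 2) * rot (n + 2) = rot (n + 1) * (σ (n + 1) * rot n) * σ n * σ (n + 1) := by
        simp only [rot, mul_assoc]
      rw [this, ← rot_mul_σ_of_lt (by omega)]
      have h2 := σ_braid n
      simp only [rot, mul_assoc] at h2 ⊢
      rw [h2]
    calc rot (n + 2) * rot (n + 2) * σ (n + 1)
        = rot (n + 1) * rot (n + 1) * (σ (n + 1) * σ n * σ (n + 1)) := by
          rw [h1]; simp only [mul_assoc]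
      _ = (rot (n + 1) * rot (n + 1) * σ n) * σ (n + 1) * σ n := by
          rw [← σ_braid]; simp only [mul_assoc]
      _ = _ := by rw [ih, h1]; simp only [mul_assoc]

theorem rot_pow_mul_σ (n k i : ℕ) (h : i + k < n) :
    rot n ^ k * σ i = σ (i + k) * rot n ^ k := by
  induction k with
  | zero => simp
  | succ k ih =>
    rw [pow_succ', mul_assoc, ih (by omega), ← mul_assoc, rot_mul_σ (by omega), mul_assoc]
    rfl

/-- The full twist on `n + 1` strands. -/
def twist (n : ℕ) : Braid := rot n ^ (n + 1)

theorem twist_mem (n : ℕ) : twist n ∈ positiveBraid := pow_mem (rot_mem n) _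

theorem commute_twist {n i : ℕ} (h : i < n) : Commute (twist n) (σ i) := by
  obtain ⟨m, rfl⟩ : ∃ m, n = m + 1 := ⟨n - 1, by omega⟩
  -- Passing `σ i` through the factors from the right: `m - i` of them turn it into `σ m`, two wrap
  -- it to `σ 0`, and the last `i` restore `σ i`.
  have e : twist (m + 1) = rot (m + 1) ^ i * (rot (m + 1) * rot (m + 1)) *
      rot (m + 1) ^ (m - i) := by
    rw [twist, ← pow_two, ← pow_add, ← pow_add]
    congr 1
    omega
  have h1 : rot (m + 1) ^ (m - i) * σ i = σ m * rot (m + 1) ^ (m - i) := by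
    simpa [show i + (m - i) = m by omega] using rot_pow_mul_σ (m + 1) (m - i) i (by omega)
  have h2 : rot (m + 1) ^ i * σ 0 = σ i * rot (m + 1) ^ i := by
    simpa using rot_pow_mul_σ (m + 1) i 0 (by omega)
  change _ * _ = _ * _
  rw [e, mul_assoc, h1, ← mul_assoc, mul_assoc (rot (m + 1) ^ i), rot_mul_rot_mul_σ, ← mul_assoc,
    h2]
  simp only [mul_assoc]

theorem exists_twist_eq {n i : ℕ} (h : i < n) : ∃ d ∈ positiveBraid, twist n = d * σ i := by
  obtain ⟨m, rfl⟩ : ∃ m, n = m + 1 := ⟨n - 1, by omega⟩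
  refine ⟨rot (m + 1) ^ (i + 1) * rot m * rot (m + 1) ^ (m - i),
    mul_mem (mul_mem (pow_mem (rot_mem _) _) (rot_mem _)) (pow_mem (rot_mem _) _), ?_⟩
  have h1 : rot (m + 1) ^ (m - i) * σ i = σ m * rot (m + 1) ^ (m - i) := by
    simpa [show i + (m - i) = m by omega] using rot_pow_mul_σ (m + 1) (m - i) i (by omega)
  rw [mul_assoc, h1, ← mul_assoc, mul_assoc _ (rot m), show rot m * σ m = rot (m + 1) from rfl,
    ← pow_succ, ← pow_add, twist]
  congr 1
  omega

/-- Each letter costs one more central twist. The claim is for all large `n` so that two braids can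
be compared through the same twist. -/
theorem exists_mul_eq_twist_pow {x : Braid} (hx : x ∈ positiveBraid) :
    ∃ N, ∀ n ≥ N, ∃ c ∈ positiveBraid, ∃ k, c * x = twist n ^ k := by
  induction hx using Submonoid.closure_induction_right with
  | one => exact ⟨0, fun n _ => ⟨1, one_mem _, 0, by simp⟩⟩
  | mul_right x _ y hy ih =>
    obtain ⟨i, rfl⟩ := hy
    obtain ⟨N, hN⟩ := ih
    refine ⟨max N (i + 1), fun n hn => ?_⟩
    obtain ⟨c, hc, k, e⟩ := hN n (le_trans (le_max_left _ _) hn)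
    have hi : i < n := le_trans (le_max_right _ _) hn
    obtain ⟨d, hd, e'⟩ := exists_twist_eq hi
    have h1 : Commute (twist n ^ k) d := by
      have : d = twist n * (σ i)⁻¹ := by rw [e', mul_inv_cancel_right]
      rw [this]
      exact ((Commute.refl _).mul_right (commute_twist hi).inv_right).pow_left k
    refine ⟨d * c, mul_mem hd hc, k + 1, ?_⟩
    rw [mul_assoc, ← mul_assoc c, e, ← mul_assoc, ← h1.eq, mul_assoc, ← e', pow_succ]

theorem exists_common_left_multiple {x y : Braid} (hx : x ∈ positiveBraid)
    (hy : y ∈ positiveBraid) : ∃ c ∈ positiveBraid, ∃ d ∈ positiveBraid, c * x = d * y := by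
  obtain ⟨N, hN⟩ := exists_mul_eq_twist_pow hx
  obtain ⟨M, hM⟩ := exists_mul_eq_twist_pow hy
  obtain ⟨c, hc, k, e⟩ := hN (max N M) (le_max_left _ _)
  obtain ⟨d, hd, l, e'⟩ := hM (max N M) (le_max_right _ _)
  refine ⟨twist (max N M) ^ l * c, mul_mem (pow_mem (twist_mem _) _) hc,
    twist (max N M) ^ k * d, mul_mem (pow_mem (twist_mem _) _) hd, ?_⟩
  rw [mul_assoc, e, mul_assoc, e', ← pow_add, ← pow_add, add_comm]

theorem exists_fraction_of_mem_braidSubgroup {x : Braid} (hx : x ∈ braidSubgroup) :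
    ∃ c ∈ positiveBraid, ∃ d ∈ positiveBraid, x = c⁻¹ * d := by
  induction hx using Subgroup.closure_induction_right with
  | one => exact ⟨1, one_mem _, 1, one_mem _, by simp⟩
  | mul_right x _ y hy ih =>
    obtain ⟨i, rfl⟩ := hy
    obtain ⟨c, hc, d, hd, rfl⟩ := ih
    exact ⟨c, hc, d * σ i, mul_mem hd (σ_mem_positiveBraid i), by rw [mul_assoc]⟩
  | mul_inv_cancel x _ y hy ih =>
    obtain ⟨i, rfl⟩ := hy
    obtain ⟨c, hc, d, hd, rfl⟩ := ih
    obtain ⟨p, hp, q, hq, e⟩ := exists_common_left_multiple hd (σ_mem_positiveBraid i)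
    refine ⟨p * c, mul_mem hp hc, q, hq, ?_⟩
    rw [mul_inv_eq_iff_eq_mul, mul_inv_rev, mul_assoc, mul_assoc, ← e, inv_mul_cancel_left]

/-- Two generators are equal or have a common left multiple of length two; these squares are stacked
along the letters of `h`. -/
theorem exists_thompson_common_multiple {h : Braid} (hh : h ∈ positiveThompson) (i : ℕ) :
    ∃ c ∈ positiveThompson, ∃ d ∈ positiveThompson, c * h = d * a i := by
  have gen : ∀ i j, (a i = a j) ∨ ∃ k l, a k * a i = a l * a j := by
    intro i j
    rcases lt_trichotomy i j with h | rfl | h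
    · exact .inr ⟨_, _, (a_mul_a h).symm⟩
    · exact .inl rfl
    · exact .inr ⟨_, _, a_mul_a h⟩
  suffices ∃ c ∈ positiveThompson, ∃ d ∈ positiveThompson,
      c * h = d * a i ∧ (c = 1 ∨ ∃ k, c = a k) by
    obtain ⟨c, hc, d, hd, e, -⟩ := this
    exact ⟨c, hc, d, hd, e⟩
  induction hh using Submonoid.closure_induction_right generalizing i with
  | one => exact ⟨a i, a_mem_positiveThompson i, 1, one_mem _, by simp, .inr ⟨i, rfl⟩⟩
  | mul_right h hh y hy ih =>
    obtain ⟨j, rfl⟩ := hy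
    rcases gen j i with e | ⟨k, l, e⟩
    · exact ⟨1, one_mem _, h, hh, by rw [one_mul, e], .inl rfl⟩
    · obtain ⟨c, hc, d, hd, e', h'⟩ := ih k
      refine ⟨c, hc, d * a l, mul_mem hd (a_mem_positiveThompson l), ?_, h'⟩
      rw [← mul_assoc, e', mul_assoc, e, mul_assoc]

theorem exists_thompson_fraction (x : Braid) :
    ∃ h' ∈ positiveThompson, ∃ γ ∈ braidSubgroup, ∃ h ∈ positiveThompson, x = h'⁻¹ * γ * h := by
  have hx : x ∈ Subgroup.closure (Set.range σ ∪ Set.range a) := by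
    have : (⊤ : Subgroup Braid) ≤ Subgroup.closure (Set.range σ ∪ Set.range a) := by
      rw [← PresentedGroup.closure_range_of rels]
      refine (Subgroup.closure_le _).2 ?_
      rintro _ ⟨g, rfl⟩
      cases g with
      | sigma i => exact Subgroup.subset_closure (.inl ⟨i, rfl⟩)
      | a i => exact Subgroup.subset_closure (.inr ⟨i, rfl⟩)
    exact this trivial
  induction hx using Subgroup.closure_induction_right with
  | one => exact ⟨1, one_mem _, 1, one_mem _, 1, one_mem _, by simp⟩
  | mul_right x _ y hy ih =>
    obtain ⟨h', hh', γ, hγ, h, hh, rfl⟩ := ih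
    rcases hy with ⟨i, rfl⟩ | ⟨i, rfl⟩
    · obtain ⟨w, hw, k, hk, e⟩ := exists_thompson_mul_σ hh i
      refine ⟨h', hh', γ * w, mul_mem hγ (mem_braidSubgroup_of_mem_positiveBraid hw), k, hk, ?_⟩
      rw [mul_assoc, e]
      simp only [mul_assoc]
    · exact ⟨h', hh', γ, hγ, h * a i, mul_mem hh (a_mem_positiveThompson i), by
        simp only [mul_assoc]⟩
  | mul_inv_cancel x _ y hy ih =>
    obtain ⟨h', hh', γ, hγ, h, hh, rfl⟩ := ih
    rcases hy with ⟨i, rfl⟩ | ⟨i, rfl⟩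
    · obtain ⟨k, hk, w, hw, e⟩ := exists_thompson_mul_σ_inv hh i
      refine ⟨h', hh', γ * w, mul_mem hγ hw, k, hk, ?_⟩
      rw [mul_assoc, e]
      simp only [mul_assoc]
    -- The only letter creating a denominator is `(a i)⁻¹`: `h (a i)⁻¹ = c⁻¹ d`, and `c⁻¹` is then
    -- carried across `γ`.
    · obtain ⟨c, hc, d, hd, e⟩ := exists_thompson_common_multiple hh i
      obtain ⟨c', hc', γ', hγ', e'⟩ := exists_thompson_mul_braid_mul_inv hc hγ
      refine ⟨c' * h', mul_mem hc' hh', γ', hγ', d, hd, ?_⟩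
      rw [mul_inv_eq_iff_eq_mul, mul_assoc _ d, ← e, ← mul_assoc, mul_assoc _ γ', ← e']
      group

/-! ### Self-distributive expansion of terms -/

/-- Terms in one variable and one binary operation. -/
inductive Term : Type
  | x : Term
  | app (s t : Term) : Term

namespace Term

/-- One step of expansion by the left self-distributivity law. -/
inductive Step : Term → Term → Prop
  | ld (s t u : Term) : Step (app s (app t u)) (app (app s t) (app s u))
  | left {s s' : Term} (t : Term) : Step s s' → Step (app s t) (app s' t)
  | right (s : Term) {t t' : Term} : Step t t' → Step (app s t) (app s t')

/-- Iterated expansion. -/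
abbrev Expands : Term → Term → Prop := Relation.ReflTransGen Step

theorem Expands.app {s s' t t' : Term} (h : Expands s s') (h' : Expands t t') :
    Expands (app s t) (app s' t') :=
  (h.lift (fun r => Term.app r t) fun _ _ => Step.left t).trans
    (h'.lift (fun r => Term.app s' r) fun _ _ => Step.right s')

/-- Full distribution of `s` in a term. -/
def dist (s : Term) : Term → Term
  | x => app s x
  | app t u => app (dist s t) (dist s u)

/-- A common expansion of all one-step expansions of a term. -/
def full : Term → Term
  | x => x
  | app s t => dist (full s) (full t)

theorem expands_dist (s t : Term) : Expands (app s t) (dist s t) := by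
  induction t with
  | x => exact .refl
  | app t u iht ihu => exact .head (.ld s t u) (iht.app ihu)

theorem Expands.dist_left {s s' : Term} (h : Expands s s') (t : Term) :
    Expands (dist s t) (dist s' t) := by
  induction t with
  | x => exact h.app .refl
  | app t u iht ihu => exact iht.app ihu

/-- `dist s` replaces every variable by `app s x`, and substitution preserves expansion steps. -/
theorem Step.dist_right (s : Term) {t t' : Term} (h : Step t t') :
    Step (dist s t) (dist s t') := by
  induction h with
  | ld p q r => exact .ld _ _ _
  | left t _ ih => exact .left _ ih
  | right s _ ih => exact .right _ ih

theorem Expands.dist {s s' t t' : Term} (h : Expands s s') (h' : Expands t t') :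
    Expands (dist s t) (dist s' t') :=
  (h.dist_left t).trans (h'.lift (fun r => Term.dist s' r) fun _ _ => Step.dist_right s')

theorem expands_full (t : Term) : Expands t (full t) := by
  induction t with
  | x => exact .refl
  | app s t ihs iht => exact (ihs.app iht).trans (expands_dist _ _)

theorem Step.expands_full {t t' : Term} (h : Step t t') : Expands t' (full t) := by
  induction h with
  | ld s t u =>
    have h1 := ((Term.expands_full s).app (Term.expands_full t)).trans (expands_dist _ _)
    have h2 := ((Term.expands_full s).app (Term.expands_full u)).trans (expands_dist _ _)
    exact (Expands.app h1 h2).trans (Expands.dist .refl (expands_dist _ _))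
  | left t _ ih => exact (ih.app (Term.expands_full t)).trans (expands_dist _ _)
  | right s _ ih => exact ((Term.expands_full s).app ih).trans (expands_dist _ _)

theorem expands_dist_dist (s t u : Term) :
    Expands (dist s (dist t u)) (dist (dist s t) (dist s u)) := by
  induction u with
  | x => exact expands_dist (dist s t) (app s x)
  | app p q ihp ihq => exact ihp.app ihq

theorem Step.full {t t' : Term} (h : Step t t') : Expands (full t) (full t') := by
  induction h with
  | ld s t u => exact expands_dist_dist _ _ _
  | left t _ ih => exact ih.dist .refl
  | right s _ ih => exact Expands.dist .refl ih

theorem Expands.full {t t' : Term} (h : Expands t t') : Expands (full t) (full t') := by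
  induction h with
  | refl => exact .refl
  | tail _ h ih => exact ih.trans h.full

/-- `full` dominates every one-step expansion and is monotone for expansion, so each step toward
`t₁` is matched by applying `full` to the common expansion found so far. -/
theorem Expands.confluent {t t₁ t₂ : Term} (h₁ : Expands t t₁) (h₂ : Expands t t₂) :
    ∃ u, Expands t₁ u ∧ Expands t₂ u := by
  induction h₁ with
  | refl => exact ⟨t₂, h₂, .refl⟩
  | tail _ h ih =>
    obtain ⟨e, h1, h2⟩ := ih
    exact ⟨Term.full e, h.expands_full.trans h1.full, h2.trans (Term.expands_full e)⟩

/-- Equivalence under the left self-distributivity law: having a common expansion. -/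
def Equiv (s t : Term) : Prop := ∃ u, Expands s u ∧ Expands t u

theorem Equiv.trans {s t u : Term} (h : Equiv s t) (h' : Equiv t u) : Equiv s u := by
  obtain ⟨p, h1, h2⟩ := h
  obtain ⟨q, h3, h4⟩ := h'
  obtain ⟨r, h5, h6⟩ := h2.confluent h3
  exact ⟨r, h1.trans h5, h4.trans h6⟩

theorem Equiv.symm {s t : Term} (h : Equiv s t) : Equiv t s :=
  let ⟨u, h1, h2⟩ := h
  ⟨u, h2, h1⟩

theorem Equiv.app_right (s : Term) {t t' : Term} (h : Equiv t t') :
    Equiv (app s t) (app s t') :=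
  let ⟨u, h1, h2⟩ := h
  ⟨app s u, Expands.app .refl h1, Expands.app .refl h2⟩

/-- Right powers of the variable. -/
def rpow : ℕ → Term
  | 0 => x
  | n + 1 => app x (rpow n)

/-- For `t = pq`, writing `rₘ` for `rpow m`: `(pq)rₘ₊₁ ~ (pq)(p rₘ) ~ p(q rₘ) ~ p rₘ₊₁ ~ rₘ₊₂`. -/
theorem exists_absorb (t : Term) : ∃ N, ∀ n ≥ N, Equiv (app t (rpow n)) (rpow (n + 1)) := by
  induction t with
  | x => exact ⟨0, fun n _ => ⟨_, .refl, .refl⟩⟩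
  | app p q ihp ihq =>
    obtain ⟨N, hN⟩ := ihp
    obtain ⟨M, hM⟩ := ihq
    refine ⟨max N M + 1, fun n hn => ?_⟩
    obtain ⟨m, rfl⟩ : ∃ m, n = m + 1 := ⟨n - 1, by omega⟩
    have h1 := hN m (by omega)
    have h2 := hM m (by omega)
    have h3 := hN (m + 1) (by omega)
    have h4 : Equiv (app p (app q (rpow m))) (app (app p q) (app p (rpow m))) :=
      ⟨_, .single (.ld _ _ _), .refl⟩
    exact ((h1.symm.app_right _).trans (h4.symm.trans (h2.app_right p))).trans h3

/-- Iterated left subterms. -/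
inductive LeftSub : Term → Term → Prop
  | refl (t : Term) : LeftSub t t
  | app {s t : Term} (u : Term) : LeftSub s t → LeftSub s (app t u)

theorem LeftSub.step {s e e' : Term} (h : LeftSub s e) (h' : Step e e') :
    ∃ s', LeftSub s' e' ∧ Expands s s' := by
  induction h generalizing e' with
  | refl => exact ⟨e', .refl _, .single h'⟩
  | app u h ih =>
    cases h' with
    | ld _ t u => exact ⟨_, .app _ (.app _ h), .refl⟩
    | left _ h' =>
      obtain ⟨s', h1, h2⟩ := ih h'
      exact ⟨s', .app _ h1, h2⟩
    | right _ h' => exact ⟨_, .app _ h, .refl⟩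

theorem LeftSub.expands {s e e' : Term} (h : LeftSub s e) (h' : Expands e e') :
    ∃ s', LeftSub s' e' ∧ Expands s s' := by
  induction h' with
  | refl => exact ⟨s, h, .refl⟩
  | tail _ h' ih =>
    obtain ⟨s', h1, h2⟩ := ih
    obtain ⟨s'', h3, h4⟩ := h1.step h'
    exact ⟨s'', h3, h2.trans h4⟩

theorem LeftSub.total {s t e : Term} (h : LeftSub s e) (h' : LeftSub t e) :
    LeftSub s t ∨ LeftSub t s := by
  induction h with
  | refl => exact .inr h'
  | app u h ih =>
    cases h' with
    | refl => exact .inl (.app u h)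
    | app _ h' => exact ih h'

/-- Applied to a large right power, `s` and `t` give equivalent terms. In a common expansion both
leave an expanded copy on the left spine, which is linearly ordered. -/
theorem exists_leftSub (s t : Term) :
    ∃ s' t', Expands s s' ∧ Expands t t' ∧ (LeftSub s' t' ∨ LeftSub t' s') := by
  obtain ⟨N, hN⟩ := exists_absorb s
  obtain ⟨M, hM⟩ := exists_absorb t
  obtain ⟨e, h1, h2⟩ := (hN (max N M) (le_max_left _ _)).trans
    (hM (max N M) (le_max_right _ _)).symm
  obtain ⟨s', h3, h4⟩ := (LeftSub.app _ (.refl s)).expands h1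
  obtain ⟨t', h5, h6⟩ := (LeftSub.app _ (.refl t)).expands h2
  exact ⟨s', t', h4, h6, h3.total h5⟩

/-- The special braid denoted by a term. -/
def eval : Term → Braid
  | x => 1
  | app s t => bracket (eval s) (eval t)

theorem isSpecialBraid_eval (t : Term) : IsSpecialBraid (eval t) := by
  induction t with
  | x => exact .one
  | app s t ihs iht => exact .bracket ihs iht

theorem Step.eval_eq {s t : Term} (h : Step s t) : eval s = eval t := by
  induction h with
  | ld s t u => exact bracket_bracket _ _ _
  | left t _ ih => simp [eval, ih]
  | right s _ ih => simp [eval, ih]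

theorem Expands.eval_eq {s t : Term} (h : Expands s t) : eval s = eval t := by
  induction h with
  | refl => rfl
  | tail _ h ih => exact ih.trans h.eval_eq

end Term

/-! ### Comparison of special braids -/

theorem IsSpecialBraid.exists_term {z : Braid} (hz : IsSpecialBraid z) :
    ∃ t : Term, t.eval = z := by
  induction hz with
  | one => exact ⟨.x, rfl⟩
  | bracket _ _ ihx ihy =>
    obtain ⟨s, rfl⟩ := ihx
    obtain ⟨t, rfl⟩ := ihy
    exact ⟨.app s t, rfl⟩

/-- Braids with an expression in which `σ 0` appears, and `(σ 0)⁻¹` does not. -/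
inductive IsSigmaPositive : Braid → Prop
  | base {u v : Braid} : u ∈ braidSubgroup → v ∈ braidSubgroup →
      IsSigmaPositive (shift u * σ 0 * shift v)
  | mul {x y : Braid} : IsSigmaPositive x → IsSigmaPositive y → IsSigmaPositive (x * y)

/-- Going one step up the left spine multiplies on the right by `y⁻¹ · y[u] = ∂u · σ₁ · ∂y⁻¹`, which
contains one `σ₁` and no inverse of it. -/
theorem Term.LeftSub.isSigmaPositive {s t : Term} (h : LeftSub s t) :
    s.eval = t.eval ∨ IsSigmaPositive (s.eval⁻¹ * t.eval) := by
  induction h with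
  | refl => exact .inl rfl
  | @app t u h ih =>
    right
    have h1 : IsSigmaPositive (t.eval⁻¹ * (Term.app t u).eval) := by
      have e : t.eval⁻¹ * (Term.app t u).eval = shift u.eval * σ 0 * shift t.eval⁻¹ := by
        simp only [Term.eval, bracket, map_inv]
        group
      rw [e]
      exact .base (isSpecialBraid_eval u).mem_braidSubgroup
        (inv_mem (isSpecialBraid_eval t).mem_braidSubgroup)
    rcases ih with e | h2
    · rwa [e]
    · have := h2.mul h1
      rwa [mul_assoc, mul_inv_cancel_left] at this

theorem IsSpecialBraid.comparison {y z : Braid} (hy : IsSpecialBraid y) (hz : IsSpecialBraid z) :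
    y = z ∨ IsSigmaPositive (y⁻¹ * z) ∨ IsSigmaPositive (z⁻¹ * y) := by
  obtain ⟨s, rfl⟩ := hy.exists_term
  obtain ⟨t, rfl⟩ := hz.exists_term
  obtain ⟨s', t', hs, ht, h⟩ := Term.exists_leftSub s t
  rw [hs.eval_eq, ht.eval_eq]
  rcases h with h | h
  · rcases h.isSigmaPositive with e | h
    · exact .inl e
    · exact .inr (.inl h)
  · rcases h.isSigmaPositive with e | h
    · exact .inl e.symm
    · exact .inr (.inr h)

/-! ### Actions on sequences of colors -/

/-- An augmented rack with a bijective second operation. -/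
structure ColorSystem (R : Type*) where
  /-- the self-distributive operation -/
  br : R → Equiv.Perm R
  /-- the second operation -/
  op : R × R ≃ R
  br_br (r t u : R) : br r (br t u) = br (br r t) (br r u)
  br_op (r t u : R) : br r (op (t, u)) = op (br r t, br r u)
  op_br (r t u : R) : br (op (r, t)) u = br r (br t u)

namespace ColorSystem

variable {R : Type*}

/-- Prepend an element to a sequence. -/
def cons (r : R) (s : ℕ → R) : ℕ → R
  | 0 => r
  | n + 1 => s n

/-- Remove the first element of a sequence. -/
def tail (s : ℕ → R) : ℕ → R := fun n => s (n + 1)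

@[simp] theorem cons_zero (r : R) (s : ℕ → R) : cons r s 0 = r := rfl

@[simp] theorem cons_succ (r : R) (s : ℕ → R) (n : ℕ) : cons r s (n + 1) = s n := rfl

@[simp] theorem tail_cons (r : R) (s : ℕ → R) : tail (cons r s) = s := rfl

@[simp] theorem tail_apply (s : ℕ → R) (n : ℕ) : tail s n = s (n + 1) := rfl

@[simp] theorem cons_tail (s : ℕ → R) : cons (s 0) (tail s) = s := by
  funext n
  cases n <;> rfl

/-- Let a permutation of sequences act on the tails. -/
def tailPerm : Equiv.Perm (ℕ → R) →* Equiv.Perm (ℕ → R) where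
  toFun p :=
    { toFun := fun s => cons (s 0) (p (tail s))
      invFun := fun s => cons (s 0) (p⁻¹ (tail s))
      left_inv := fun s => by simp
      right_inv := fun s => by simp }
  map_one' := by ext s : 1; simp
  map_mul' p q := by ext s : 1; simp

@[simp] theorem tailPerm_apply (p : Equiv.Perm (ℕ → R)) (s : ℕ → R) :
    tailPerm p s = cons (s 0) (p (tail s)) := rfl

variable (C : ColorSystem R)

/-- The action of the first braid generator. -/
def crossing : Equiv.Perm (ℕ → R) where
  toFun s := cons (C.br (s 0) (s 1)) (cons (s 0) (tail (tail s)))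
  invFun s := cons (s 1) (cons ((C.br (s 1)).symm (s 0)) (tail (tail s)))
  left_inv s := by funext n; match n with | 0 | 1 | n + 2 => simp
  right_inv s := by funext n; match n with | 0 | 1 | n + 2 => simp

@[simp] theorem crossing_apply (s : ℕ → R) :
    C.crossing s = cons (C.br (s 0) (s 1)) (cons (s 0) (tail (tail s))) := rfl

/-- The action of the first Thompson generator. -/
def merge : Equiv.Perm (ℕ → R) where
  toFun s := cons (C.op (s 0, s 1)) (tail (tail s))
  invFun s := cons (C.op.symm (s 0)).1 (cons (C.op.symm (s 0)).2 (tail s))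
  left_inv s := by funext n; match n with | 0 | 1 | n + 2 => simp
  right_inv s := by funext n; match n with | 0 | 1 | n + 2 => simp

@[simp] theorem merge_apply (s : ℕ → R) :
    C.merge s = cons (C.op (s 0, s 1)) (tail (tail s)) := rfl

/-- The action of the generators. -/
def genPerm : Gen → Equiv.Perm (ℕ → R)
  | .sigma i => tailPerm^[i] C.crossing
  | .a i => tailPerm^[i] C.merge

theorem genPerm_succ (g : Gen) : C.genPerm g.succ = tailPerm (C.genPerm g) := by
  cases g <;> exact Function.iterate_succ_apply' _ _ _

theorem tailPerm_tailPerm_mul_crossing (p : Equiv.Perm (ℕ → R)) :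
    tailPerm (tailPerm p) * C.crossing = C.crossing * tailPerm (tailPerm p) := by
  ext s n
  match n with | 0 | 1 | n + 2 => simp

theorem tailPerm_mul_merge (p : Equiv.Perm (ℕ → R)) :
    tailPerm p * C.merge = C.merge * tailPerm (tailPerm p) := by
  ext s n
  match n with | 0 | n + 1 => simp

/-- A relation at index `i` is the `i`-fold `tailPerm` of the one at index `0`, where the three laws
of a color system give the braid relation and the two mixed ones. The opposite group appears because
the action is on the right. -/
theorem lift_genPerm_rel {u v : FreeGroup Gen} (h : Rel u v) :
    FreeGroup.lift (fun g => MulOpposite.op (C.genPerm g)) u =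
      FreeGroup.lift (fun g => MulOpposite.op (C.genPerm g)) v := by
  have push : ∀ (i : ℕ) (p q p' q' : Equiv.Perm (ℕ → R)), p * q = p' * q' →
      tailPerm^[i] p * tailPerm^[i] q = tailPerm^[i] p' * tailPerm^[i] q' := by
    intro i p q p' q' e
    rw [← iterate_map_mul, e, iterate_map_mul]
  have push3 : ∀ (i : ℕ) (p q r p' q' r' : Equiv.Perm (ℕ → R)), p * (q * r) = p' * (q' * r') →
      tailPerm^[i] p * (tailPerm^[i] q * tailPerm^[i] r) =
        tailPerm^[i] p' * (tailPerm^[i] q' * tailPerm^[i] r') := by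
    intro i p q r p' q' r' e
    rw [← iterate_map_mul, ← iterate_map_mul, e, iterate_map_mul,
      iterate_map_mul]
  have push32 : ∀ (i : ℕ) (p q r p' q' : Equiv.Perm (ℕ → R)), p * (q * r) = p' * q' →
      tailPerm^[i] p * (tailPerm^[i] q * tailPerm^[i] r) =
        tailPerm^[i] p' * tailPerm^[i] q' := by
    intro i p q r p' q' e
    rw [← iterate_map_mul, ← iterate_map_mul, e, iterate_map_mul]
  cases h <;> simp only [map_mul, FreeGroup.lift_apply_of, ← MulOpposite.op_mul, genPerm] <;>
    congr 1
  case sigma_sigma i j h =>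
    obtain ⟨k, rfl⟩ := Nat.exists_eq_add_of_le h
    rw [add_assoc, Function.iterate_add_apply]
    refine push i _ _ _ _ ?_
    rw [add_comm, Function.iterate_succ_apply', Function.iterate_succ_apply']
    exact C.tailPerm_tailPerm_mul_crossing _
  case sigma_a i j h =>
    obtain ⟨k, rfl⟩ := Nat.exists_eq_add_of_le h
    rw [add_assoc, Function.iterate_add_apply]
    refine push i _ _ _ _ ?_
    rw [add_comm, Function.iterate_succ_apply', Function.iterate_succ_apply']
    exact C.tailPerm_tailPerm_mul_crossing _
  case a_a i j h =>
    obtain ⟨k, rfl⟩ := Nat.exists_eq_add_of_le h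
    rw [show i + 1 + k + 1 = i + (k + 2) by omega, show i + 1 + k = i + (k + 1) by omega,
      Function.iterate_add_apply _ i (k + 2), Function.iterate_add_apply _ i (k + 1)]
    refine push i _ _ _ _ ?_
    rw [Function.iterate_succ_apply', Function.iterate_succ_apply',
      Function.iterate_succ_apply']
    exact C.tailPerm_mul_merge _
  case a_sigma i j h =>
    obtain ⟨k, rfl⟩ := Nat.exists_eq_add_of_le h
    rw [show i + 1 + k + 1 = i + (k + 2) by omega, show i + 1 + k = i + (k + 1) by omega,
      Function.iterate_add_apply _ i (k + 2), Function.iterate_add_apply _ i (k + 1)]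
    refine push i _ _ _ _ ?_
    rw [Function.iterate_succ_apply', Function.iterate_succ_apply',
      Function.iterate_succ_apply']
    exact C.tailPerm_mul_merge _
  case braid i =>
    rw [Function.iterate_succ_apply]
    refine push3 i _ _ _ _ _ _ ?_
    ext s n
    match n with
    | 0 => simpa using (C.br_br _ _ _).symm
    | 1 | 2 | n + 3 => simp
  case sigma_sigma_a i =>
    rw [Function.iterate_succ_apply, Function.iterate_succ_apply]
    refine push32 i _ _ _ _ _ ?_
    ext s n
    match n with | 0 | 1 | n + 2 => simp [C.op_br]
  case sigma_sigma_a' i =>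
    rw [Function.iterate_succ_apply, Function.iterate_succ_apply]
    refine push32 i _ _ _ _ _ ?_
    ext s n
    match n with | 0 | 1 | n + 2 => simp [C.br_op]

/-- The right action on sequences, as a homomorphism. -/
def actHom : Braid →* (Equiv.Perm (ℕ → R))ᵐᵒᵖ :=
  PresentedGroup.toGroup (f := fun g => MulOpposite.op (C.genPerm g)) (by
    rintro _ ⟨u, v, h, rfl⟩
    rw [map_mul, map_inv, C.lift_genPerm_rel h, mul_inv_cancel])

/-- The right action on sequences. -/
def act (s : ℕ → R) (x : Braid) : ℕ → R := (C.actHom x).unop s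

@[simp] theorem act_one (s : ℕ → R) : C.act s 1 = s := by simp [act]

theorem act_mul (s : ℕ → R) (x y : Braid) : C.act s (x * y) = C.act (C.act s x) y := by
  simp [act]

@[simp] theorem act_act_inv (s : ℕ → R) (x : Braid) : C.act (C.act s x⁻¹) x = s := by
  rw [← act_mul, inv_mul_cancel, act_one]

theorem act_injective {s t : ℕ → R} {x : Braid} (h : C.act s x = C.act t x) : s = t :=
  (C.actHom x).unop.injective h

theorem actHom_of (g : Gen) :
    C.actHom (PresentedGroup.of g) = MulOpposite.op (C.genPerm g) :=
  PresentedGroup.toGroup.of _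

theorem act_σ_zero (s : ℕ → R) :
    C.act s (σ 0) = cons (C.br (s 0) (s 1)) (cons (s 0) (tail (tail s))) := by
  rw [act, σ, actHom_of]
  rfl

theorem act_a_zero (s : ℕ → R) : C.act s (a 0) = cons (C.op (s 0, s 1)) (tail (tail s)) := by
  rw [act, a, actHom_of]
  rfl

theorem act_shift (s : ℕ → R) (x : Braid) :
    C.act s (shift x) = cons (s 0) (C.act (tail s) x) := by
  have : C.actHom.comp shift = (MonoidHom.op tailPerm).comp C.actHom := by
    refine hom_ext (fun i => ?_) (fun i => ?_)
    · simp only [MonoidHom.comp_apply, shift_σ]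
      rw [σ, σ, actHom_of, actHom_of]
      exact congrArg MulOpposite.op (C.genPerm_succ (.sigma i))
    · simp only [MonoidHom.comp_apply, shift_a]
      rw [a, a, actHom_of, actHom_of]
      exact congrArg MulOpposite.op (C.genPerm_succ (.a i))
  have h := DFunLike.congr_fun this x
  simp only [MonoidHom.comp_apply] at h
  rw [act, h]
  rfl

/-- Braids act through `br` alone, so compatibility of `F` with `op` is not required. -/
theorem act_map {F : R → R} (hb : ∀ r t, F (C.br r t) = C.br (F r) (F t)) (s : ℕ → R)
    {x : Braid} (hx : x ∈ braidSubgroup) : C.act (F ∘ s) x = F ∘ C.act s x := by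
  induction hx using Subgroup.closure_induction generalizing s with
  | one => simp
  | mul x y _ _ ihx ihy => rw [act_mul, act_mul, ihx, ihy]
  | inv x _ ih =>
    apply C.act_injective (x := x)
    rw [act_act_inv, ih, act_act_inv]
  | mem x h =>
    obtain ⟨i, rfl⟩ := h
    induction i generalizing s with
    | zero =>
      rw [act_σ_zero, act_σ_zero]
      funext n
      match n with | 0 | 1 | n + 2 => simp [hb]
    | succ i ih =>
      rw [← shift_σ, act_shift, act_shift]
      have := ih (tail s)
      funext n
      match n with
      | 0 => simp
      | n + 1 => exact congrFun this n

end ColorSystem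

/-! ### Trees of colors -/

/-- Binary trees with labelled leaves. -/
inductive Tree (α : Type*) : Type _
  | leaf (x : α) : Tree α
  | node (l r : Tree α) : Tree α

namespace Tree

/-- Relabel the leaves. -/
def map {α β : Type*} (f : α → β) : Tree α → Tree β
  | leaf x => leaf (f x)
  | node l r => node (map f l) (map f r)

/-- The list of labels. -/
def leaves {α : Type*} : Tree α → List α
  | leaf x => [x]
  | node l r => leaves l ++ leaves r

theorem eq_of_map_eq {α : Type*} {t t' : Tree α} {m m' : List α}
    (hs : t.map (fun _ => ()) = t'.map (fun _ => ())) (hl : t.leaves ++ m = t'.leaves ++ m') :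
    t = t' ∧ m = m' := by
  induction t generalizing t' m m' with
  | leaf x =>
    cases t' with
    | leaf y => simpa [leaves] using hl
    | node l r => simp [map] at hs
  | node l r ihl ihr =>
    cases t' with
    | leaf y => simp [map] at hs
    | node l' r' =>
      simp only [map, node.injEq] at hs
      simp only [leaves, List.append_assoc] at hl
      obtain ⟨rfl, h⟩ := ihl hs.1 hl
      obtain ⟨rfl, h'⟩ := ihr hs.2 h
      exact ⟨rfl, h'⟩

/-- Evaluate a tree, with `circ` at the nodes. -/
def eval : Tree Braid → Braid
  | leaf x => x
  | node l r => circ (eval l) (eval r)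

/-- The action on a color of all leaves of a tree. -/
def actLeaf : Tree Braid → Braid → Braid
  | leaf x, b => bracket x b
  | node l r, b => actLeaf l (actLeaf r b)

theorem actLeaf_eq (t : Tree Braid) (b : Braid) : actLeaf t b = bracket (eval t) b := by
  induction t generalizing b with
  | leaf x => rfl
  | node l r ihl ihr => rw [actLeaf, ihl, ihr, eval, circ_bracket]

theorem eval_map_actLeaf (t s : Tree Braid) :
    eval (s.map (actLeaf t)) = bracket (eval t) (eval s) := by
  induction s with
  | leaf x => exact actLeaf_eq t x
  | node l r ihl ihr => rw [map, eval, ihl, ihr, eval, bracket_circ]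

theorem leaves_map {α β : Type*} (f : α → β) (t : Tree α) :
    (t.map f).leaves = t.leaves.map f := by
  induction t with
  | leaf x => rfl
  | node l r ihl ihr => simp [map, leaves, ihl, ihr]

theorem isSpecialBraid_actLeaf {t : Tree Braid} (ht : ∀ x ∈ t.leaves, IsSpecialBraid x)
    {b : Braid} (hb : IsSpecialBraid b) : IsSpecialBraid (actLeaf t b) := by
  induction t generalizing b with
  | leaf x => exact .bracket (ht x (by simp [leaves])) hb
  | node l r ihl ihr =>
    exact ihl (fun x hx => ht x (by simp [leaves, hx]))
      (ihr (fun x hx => ht x (by simp [leaves, hx])) hb)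

/-- The special Thompson element associated with a tree. -/
def shape : Tree Unit → Braid
  | leaf _ => 1
  | node l r => circ (shape l) (shape r)

/-- Forget the labels. -/
def skeleton {α : Type*} (t : Tree α) : Tree Unit := t.map fun _ => ()

/-- A shape with `n` leaves merges `n` strands into one: what lies beyond one strand afterwards lies
beyond `n` strands before. -/
theorem shape_mul_shift {α : Type*} (t : Tree α) (w : Braid) :
    t.skeleton.shape * shift w = shift^[t.leaves.length] w * t.skeleton.shape := by
  induction t generalizing w with
  | leaf x => simp [skeleton, map, shape, leaves]
  | node l r ihl ihr =>
    simp only [skeleton] at ihl ihr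
    simp only [skeleton, map, shape, leaves, circ, List.length_append]
    rw [mul_assoc, a_zero_mul_shift, ← mul_assoc, mul_assoc _ (shift _) (shift (shift w)),
      ← map_mul, ihr, map_mul, ← mul_assoc, ihl, Function.iterate_add_apply]
    simp only [mul_assoc]

theorem eval_eq (t : Tree Braid) : t.eval = shiftedProd t.leaves * t.skeleton.shape := by
  induction t with
  | leaf x => simp [eval, leaves, skeleton, map, shape]
  | node l r ihl ihr =>
    have h := shape_mul_shift l (shiftedProd r.leaves)
    simp only [skeleton] at ihl ihr h
    simp only [eval, leaves, skeleton, map, shape, circ, ihl, ihr, shiftedProd_append]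
    rw [map_mul, mul_assoc (shiftedProd l.leaves), ← mul_assoc (shape _) (shift _), h]
    simp only [mul_assoc]

theorem shiftedProd_map_eval (l : List (Tree Braid)) :
    shiftedProd (l.map eval) =
      shiftedProd (l.flatMap leaves) * shiftedProd ((l.map skeleton).map shape) := by
  induction l with
  | nil => simp
  | cons t l ih =>
    simp only [List.map_cons, List.flatMap_cons, shiftedProd_cons, shiftedProd_append, eval_eq] at ih ⊢
    rw [ih, map_mul, mul_assoc (shiftedProd t.leaves), ← mul_assoc (shape _), shape_mul_shift]
    simp only [mul_assoc]

theorem eq_of_skeleton_eq {l l' : List (Tree Braid)} (hs : l.map skeleton = l'.map skeleton)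
    (hl : l.flatMap leaves = l'.flatMap leaves) : l = l' := by
  induction l generalizing l' with
  | nil => simpa using hs.symm
  | cons t l ih =>
    cases l' with
    | nil => simp at hs
    | cons t' l' =>
      simp only [List.map_cons, List.cons.injEq] at hs
      simp only [List.flatMap_cons] at hl
      obtain ⟨rfl, h⟩ := eq_of_map_eq hs.1 hl
      rw [ih hs.2 h]

theorem length_leaves {α β : Type*} {t : Tree α} {t' : Tree β} (h : t.skeleton = t'.skeleton) :
    t.leaves.length = t'.leaves.length := by
  have h1 := congrArg (fun t => t.leaves.length) h
  simpa [skeleton, leaves_map] using h1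

theorem length_flatMap_leaves {α β : Type*} {l : List (Tree α)} {l' : List (Tree β)}
    (h : l.map skeleton = l'.map skeleton) :
    (l.flatMap leaves).length = (l'.flatMap leaves).length := by
  induction l generalizing l' with
  | nil => simp [show l' = [] by simpa using h.symm]
  | cons t l ih =>
    cases l' with
    | nil => simp at h
    | cons t' l' =>
      simp only [List.map_cons, List.cons.injEq] at h
      simp only [List.flatMap_cons, List.length_append, length_leaves h.1, ih h.2]

end Tree

/-- A bracket of two trees keeps the shape of the second and acts on each of its leaves by all
leaves of the first, so `∘` never occurs inside a bracket. -/
theorem IsSpecial.exists_tree {z : Braid} (hz : IsSpecial z) :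
    ∃ t : Tree Braid, (∀ x ∈ t.leaves, IsSpecialBraid x) ∧ t.eval = z := by
  induction hz with
  | one => exact ⟨.leaf 1, by simpa [Tree.leaves] using IsSpecialBraid.one, rfl⟩
  | bracket _ _ ihx ihy =>
    obtain ⟨t, ht, rfl⟩ := ihx
    obtain ⟨s, hs, rfl⟩ := ihy
    refine ⟨s.map t.actLeaf, ?_, t.eval_map_actLeaf s⟩
    rw [Tree.leaves_map]
    intro x hx
    obtain ⟨b, hb, rfl⟩ := List.mem_map.1 hx
    exact Tree.isSpecialBraid_actLeaf ht (hs b hb)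
  | circ _ _ ihx ihy =>
    obtain ⟨t, ht, rfl⟩ := ihx
    obtain ⟨s, hs, rfl⟩ := ihy
    refine ⟨.node t s, fun x hx => ?_, rfl⟩
    rcases List.mem_append.1 hx with h | h
    · exact ht x h
    · exact hs x h

theorem IsSpecialThompson.exists_tree {z : Braid} (hz : IsSpecialThompson z) :
    ∃ t : Tree Unit, t.shape = z := by
  induction hz with
  | one => exact ⟨.leaf (), rfl⟩
  | circ _ _ ihx ihy =>
    obtain ⟨t, rfl⟩ := ihx
    obtain ⟨s, rfl⟩ := ihy
    exact ⟨.node t s, rfl⟩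

/-! ### Trees are determined by the action on functions on the Cantor space -/

open ColorSystem

/-- Functions on the Cantor space, colored trivially. -/
def cantorColor : ColorSystem ((ℕ → Bool) → ℕ) where
  br _ := 1
  op :=
    { toFun p w := cond (w 0) (p.2 (tail w)) (p.1 (tail w))
      invFun f := (fun w => f (cons false w), fun w => f (cons true w))
      left_inv _ := rfl
      right_inv f := by
        funext w
        have h := cons_tail w
        cases e : w 0 <;> rw [e] at h <;> simp [e, h] }
  br_br _ _ _ := rfl
  br_op _ _ _ := rfl
  op_br _ _ _ := rfl

theorem cantorColor_op_false (f g : (ℕ → Bool) → ℕ) (w : ℕ → Bool) :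
    cantorColor.op (f, g) (cons false w) = f w := rfl

open Classical in
/-- The number of leading zeros (by convention `0` for the zero sequence). -/
noncomputable def leadingZeros (w : ℕ → Bool) : ℕ :=
  if h : ∃ n, w n = true then Nat.find h else 0

theorem leadingZeros_true (w : ℕ → Bool) : leadingZeros (cons true w) = 0 := by
  classical
  have h : ∃ n, cons true w n = true := ⟨0, rfl⟩
  rw [leadingZeros, dif_pos h, Nat.find_eq_zero]
  rfl

theorem leadingZeros_false {w : ℕ → Bool} (h : ∃ n, w n = true) :
    leadingZeros (cons false w) = leadingZeros w + 1 := by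
  classical
  have h' : ∃ n, cons false w n = true := ⟨h.choose + 1, h.choose_spec⟩
  rw [leadingZeros, leadingZeros, dif_pos h, dif_pos h', Nat.find_comp_succ h' h (by simp)]
  congr

namespace Tree

/-- The color of a tree. -/
noncomputable def color : Tree Unit → (ℕ → Bool) → ℕ
  | leaf _ => leadingZeros
  | node l r => cantorColor.op (color l, color r)

theorem color_eq_zero (t : Tree Unit) : ∃ w, (∃ n, w n = true) ∧ t.color w = 0 := by
  induction t with
  | leaf _ => exact ⟨cons true fun _ => true, ⟨0, rfl⟩, leadingZeros_true _⟩
  | node l r ihl _ =>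
    obtain ⟨w, ⟨n, hn⟩, h⟩ := ihl
    exact ⟨cons false w, ⟨n + 1, hn⟩, h⟩

/-- The left subtree's color vanishes at some nonzero `w`, so the node's color vanishes at `0w`,
where `leadingZeros` is at least one. Nonzero `w` avoids the conventional value. -/
theorem color_node_ne (l r : Tree Unit) : (node l r).color ≠ leadingZeros := by
  intro h
  obtain ⟨w, hw, e⟩ := l.color_eq_zero
  have := congrFun h (cons false w)
  rw [leadingZeros_false hw, color, cantorColor_op_false, e] at this
  omega

theorem color_injective : Function.Injective color := by
  intro t t' h
  induction t generalizing t' with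
  | leaf _ =>
    cases t' with
    | leaf _ => rfl
    | node l r => exact absurd h.symm (color_node_ne l r)
  | node l r ihl ihr =>
    cases t' with
    | leaf _ => exact absurd h (color_node_ne l r)
    | node l' r' =>
      have := Prod.ext_iff.1 (cantorColor.op.injective h)
      rw [ihl this.1, ihr this.2]

theorem act_shape (t : Tree Unit) :
    cantorColor.act (fun _ => leadingZeros) t.shape = cons t.color fun _ => leadingZeros := by
  induction t with
  | leaf _ => rw [shape, act_one]; exact (cons_tail _).symm
  | node l r ihl ihr =>
    rw [shape, circ, act_mul, act_mul, ihl, act_shift, tail_cons, ihr, act_a_zero]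
    rfl

theorem act_shiftedProd_shape (l : List (Tree Unit)) :
    cantorColor.act (fun _ => leadingZeros) (shiftedProd (l.map shape)) =
      (l.map color).foldr cons fun _ => leadingZeros := by
  induction l with
  | nil => simp
  | cons t l ih =>
    rw [List.map_cons, shiftedProd_cons, act_mul, act_shape, act_shift, tail_cons, ih]
    rfl

end Tree

theorem foldr_cons_injective {R : Type*} {s : ℕ → R} {l l' : List R} (h : l.length = l'.length)
    (e : l.foldr cons s = l'.foldr cons s) : l = l' := by
  induction l generalizing l' with
  | nil => exact (List.length_eq_zero_iff.1 h.symm).symm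
  | cons x l ih =>
    cases l' with
    | nil => simp at h
    | cons y l' =>
      have h0 := congrFun e 0
      have h1 := congrArg tail e
      simp only [List.foldr_cons, cons_zero, tail_cons] at h0 h1
      rw [h0, ih (by simpa using h) h1]

theorem cantorColor_act_const {x : Braid} (hx : x ∈ braidSubgroup) (f : (ℕ → Bool) → ℕ) :
    cantorColor.act (fun _ => f) x = fun _ => f := by
  induction hx using Subgroup.closure_induction with
  | one => simp
  | mul x y _ _ ihx ihy => rw [act_mul, ihx, ihy]
  | inv x _ ih =>
    apply cantorColor.act_injective (x := x)
    rw [act_act_inv, ih]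
  | mem x h =>
    obtain ⟨i, rfl⟩ := h
    induction i with
    | zero =>
      rw [act_σ_zero]
      funext n
      match n with | 0 | 1 | n + 2 => rfl
    | succ i ih =>
      rw [← shift_σ, act_shift]
      exact (congrArg _ ih).trans (cons_tail fun _ => f)

/-- On a constant sequence the braid factor is invisible; the Thompson factor then writes the
injective colors of the trees at the front. -/
theorem shape_unique {β β' : Braid} (hβ : β ∈ braidSubgroup) (hβ' : β' ∈ braidSubgroup)
    {l l' : List (Tree Unit)} (hl : l.length = l'.length)
    (e : β * shiftedProd (l.map Tree.shape) = β' * shiftedProd (l'.map Tree.shape)) :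
    l = l' := by
  have h := congrArg (cantorColor.act fun _ => leadingZeros) e
  rw [act_mul, act_mul, cantorColor_act_const hβ, cantorColor_act_const hβ',
    Tree.act_shiftedProd_shape, Tree.act_shiftedProd_shape] at h
  exact Tree.color_injective.list_map (foldr_cons_injective (by simpa using hl) h)

/-! ### The Artin action and positivity -/

/-- The first letter of the reduced word of an element of a free group. -/
def firstLetter (g : FreeGroup ℕ) : Option (ℕ × Bool) := g.toWord.head?

theorem firstLetter_one : firstLetter 1 = none := rfl

theorem firstLetter_mk_mul {n : ℕ} {b : Bool} {g : FreeGroup ℕ}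
    (h : firstLetter g ≠ some (n, !b)) :
    firstLetter (FreeGroup.mk [(n, b)] * g) = some (n, b) := by
  rw [firstLetter] at h ⊢
  rw [FreeGroup.toWord_mul, FreeGroup.toWord_mk, FreeGroup.reduce_singleton, List.singleton_append,
    FreeGroup.reduce.cons, FreeGroup.reduce_toWord]
  cases e : g.toWord with
  | nil => rfl
  | cons x l =>
    rw [e] at h
    have : ¬ (n = x.1 ∧ b = !x.2) := by
      rintro ⟨h1, h2⟩
      apply h
      simp [h1, h2]
    simp only [this, if_false, List.head?_cons]

theorem firstLetter_of_mul {n : ℕ} {g : FreeGroup ℕ} (h : firstLetter g ≠ some (n, false)) :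
    firstLetter (FreeGroup.of n * g) = some (n, true) :=
  firstLetter_mk_mul h

theorem firstLetter_inv_mul {n : ℕ} {g : FreeGroup ℕ} (h : firstLetter g ≠ some (n, true)) :
    firstLetter ((FreeGroup.of n)⁻¹ * g) = some (n, false) :=
  firstLetter_mk_mul h

theorem reduced_induction {p : FreeGroup ℕ → Prop} (one : p 1)
    (pos : ∀ n g, firstLetter g ≠ some (n, false) → p g → p (FreeGroup.of n * g))
    (neg : ∀ n g, firstLetter g ≠ some (n, true) → p g → p ((FreeGroup.of n)⁻¹ * g))
    (g : FreeGroup ℕ) : p g := by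
  suffices ∀ l : List (ℕ × Bool), FreeGroup.IsReduced l → p (FreeGroup.mk l) by
    rw [← FreeGroup.mk_toWord (x := g)]
    exact this _ FreeGroup.isReduced_toWord
  intro l
  induction l with
  | nil => exact fun _ => one
  | cons x l ih =>
    intro h
    have h' : FreeGroup.IsReduced l := List.IsChain.tail h
    have hl : firstLetter (FreeGroup.mk l) ≠ some (x.1, !x.2) := by
      rw [firstLetter, FreeGroup.toWord_mk, h'.reduce_eq]
      cases l with
      | nil => simp
      | cons y l =>
        intro e
        have := (FreeGroup.isReduced_cons_cons.1 h).1
        simp only [List.head?_cons, Option.some.injEq] at e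
        subst e
        simpa using this rfl
    obtain ⟨n, b⟩ := x
    cases b with
    | false => exact neg n _ hl (ih h')
    | true => exact pos n _ hl (ih h')

/-- The Artin endomorphism associated with `σ k`. -/
def artin (k : ℕ) : FreeGroup ℕ →* FreeGroup ℕ :=
  FreeGroup.lift fun n =>
    if n = k then FreeGroup.of k * FreeGroup.of (k + 1) * (FreeGroup.of k)⁻¹
    else if n = k + 1 then FreeGroup.of k else FreeGroup.of n

theorem artin_self (k : ℕ) : artin k (.of k) = .of k * (.of (k + 1) * (.of k)⁻¹) := by
  simp [artin, mul_assoc]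

theorem artin_succ (k : ℕ) : artin k (.of (k + 1)) = .of k := by
  simp [artin]

theorem artin_of_ne {k n : ℕ} (h : n ≠ k) (h' : n ≠ k + 1) : artin k (.of n) = .of n := by
  simp [artin, h, h']

/-- The possible first letters of the image of an element under the Artin endomorphism,
in terms of the first letter of the element. -/
inductive ArtinHead (k : ℕ) : Option (ℕ × Bool) → FreeGroup ℕ → Prop
  | one : ArtinHead k none 1
  | pos (v : FreeGroup ℕ) : firstLetter v = some (k + 1, true) →
      ArtinHead k (some (k, true)) (.of k * v)
  | neg (v : FreeGroup ℕ) : firstLetter v = some (k + 1, false) →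
      ArtinHead k (some (k, false)) (.of k * v)
  | succ_pos (v : FreeGroup ℕ) : firstLetter v ≠ some (k, false) →
      firstLetter v ≠ some (k + 1, true) → firstLetter v ≠ some (k + 1, false) →
      ArtinHead k (some (k + 1, true)) (.of k * v)
  | succ_neg (w : FreeGroup ℕ) : (firstLetter w = some (k, false) ∨
      firstLetter w = some (k + 1, true) ∨ firstLetter w = some (k + 1, false)) →
      ArtinHead k (some (k + 1, false)) w
  | other (n : ℕ) (b : Bool) (w : FreeGroup ℕ) : n ≠ k → n ≠ k + 1 →
      firstLetter w = some (n, b) → ArtinHead k (some (n, b)) w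

/-- Induction on the reduced word. The first letter of the image alone is not enough: a leading
`x_k` may cancel against the next factor, so the constructors also control the letter behind it. -/
theorem artinHead (k : ℕ) (g : FreeGroup ℕ) : ArtinHead k (firstLetter g) (artin k g) := by
  induction g using reduced_induction with
  | one => rw [map_one]; exact .one
  | pos n g hg ih =>
    rw [firstLetter_of_mul hg, map_mul]
    generalize artin k g = w at ih ⊢
    generalize firstLetter g = o at hg ih
    by_cases h1 : n = k
    · subst h1
      rw [artin_self, mul_assoc, mul_assoc]
      refine .pos _ (firstLetter_of_mul ?_)
      cases ih with
      | one => rw [firstLetter_inv_mul (by simp [firstLetter_one])]; simp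
      | pos v h => rw [inv_mul_cancel_left, h]; simp
      | neg v h => exact absurd rfl hg
      | succ_pos v h h' h'' => rwa [inv_mul_cancel_left]
      | succ_neg w h =>
        rw [firstLetter_inv_mul (by rcases h with h | h | h <;> simp [h])]; simp
      | other m b w h h' e => rw [firstLetter_inv_mul (by simp [e, h])]; simp
    by_cases h2 : n = k + 1
    · subst h2
      rw [artin_succ]
      cases ih with
      | one =>
        exact .succ_pos _ (by simp [firstLetter_one]) (by simp [firstLetter_one])
          (by simp [firstLetter_one])
      | pos v h =>
        have := firstLetter_of_mul (n := k) (g := v) (by simp [h])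
        exact .succ_pos _ (by simp [this]) (by simp [this]) (by simp [this])
      | neg v h =>
        have := firstLetter_of_mul (n := k) (g := v) (by simp [h])
        exact .succ_pos _ (by simp [this]) (by simp [this]) (by simp [this])
      | succ_pos v h h' h'' =>
        have := firstLetter_of_mul (n := k) (g := v) h
        exact .succ_pos _ (by simp [this]) (by simp [this]) (by simp [this])
      | succ_neg w h => exact absurd rfl hg
      | other m b w h h' e =>
        exact .succ_pos _ (by simp [e, h]) (by simp [e, h']) (by simp [e, h'])
    · rw [artin_of_ne h1 h2]
      refine .other n true _ h1 h2 (firstLetter_of_mul ?_)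
      cases ih with
      | one => simp [firstLetter_one]
      | pos v h => rw [firstLetter_of_mul (by simp [h])]; simp
      | neg v h => rw [firstLetter_of_mul (by simp [h])]; simp
      | succ_pos v h h' h'' => rw [firstLetter_of_mul h]; simp
      | succ_neg w h => rcases h with h | h | h <;> simp [h, Ne.symm h1, Ne.symm h2]
      | other m b w h h' e => rwa [e]
  | neg n g hg ih =>
    rw [firstLetter_inv_mul hg, map_mul, map_inv]
    generalize artin k g = w at ih ⊢
    generalize firstLetter g = o at hg ih
    by_cases h1 : n = k
    · subst h1
      rw [artin_self, mul_inv_rev, mul_inv_rev, inv_inv, mul_assoc, mul_assoc]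
      refine .neg _ (firstLetter_inv_mul ?_)
      cases ih with
      | one => rw [firstLetter_inv_mul (by simp [firstLetter_one])]; simp
      | pos v h => exact absurd rfl hg
      | neg v h => rw [inv_mul_cancel_left, h]; simp
      | succ_pos v h h' h'' => rwa [inv_mul_cancel_left]
      | succ_neg w h =>
        rw [firstLetter_inv_mul (by rcases h with h | h | h <;> simp [h])]; simp
      | other m b w h h' e => rw [firstLetter_inv_mul (by simp [e, h])]; simp
    by_cases h2 : n = k + 1
    · subst h2
      rw [artin_succ]
      refine .succ_neg _ ?_
      cases ih with
      | one => exact .inl (firstLetter_inv_mul (by simp [firstLetter_one]))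
      | pos v h => rw [inv_mul_cancel_left]; exact .inr (.inl h)
      | neg v h => rw [inv_mul_cancel_left]; exact .inr (.inr h)
      | succ_pos v h h' h'' => exact absurd rfl hg
      | succ_neg w h =>
        exact .inl (firstLetter_inv_mul (by rcases h with h | h | h <;> simp [h]))
      | other m b w h h' e => exact .inl (firstLetter_inv_mul (by simp [e, h]))
    · rw [artin_of_ne h1 h2]
      refine .other n false _ h1 h2 (firstLetter_inv_mul ?_)
      cases ih with
      | one => simp [firstLetter_one]
      | pos v h => rw [firstLetter_of_mul (by simp [h])]; simp [Ne.symm h1]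
      | neg v h => rw [firstLetter_of_mul (by simp [h])]; simp [Ne.symm h1]
      | succ_pos v h h' h'' => rw [firstLetter_of_mul h]; simp [Ne.symm h1]
      | succ_neg w h => rcases h with h | h | h <;> simp [h, Ne.symm h2]
      | other m b w h h' e => rwa [e]

theorem firstLetter_artin_self {k : ℕ} {g : FreeGroup ℕ} (h : firstLetter g = some (k, true)) :
    firstLetter (artin k g) = some (k, true) := by
  have := artinHead k g
  rw [h] at this
  generalize artin k g = w at this
  cases this with
  | pos v h => exact firstLetter_of_mul (by simp [h])
  | other _ _ _ h => exact absurd rfl h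

theorem firstLetter_artin_iff {k m : ℕ} (h : m < k) {b : Bool} {g : FreeGroup ℕ} :
    firstLetter (artin k g) = some (m, b) ↔ firstLetter g = some (m, b) := by
  have := artinHead k g
  generalize artin k g = w at this
  generalize firstLetter g = o at this
  have h1 : k ≠ m := by omega
  have h2 : k + 1 ≠ m := by omega
  cases this with
  | one => simp [firstLetter_one]
  | pos v h => rw [firstLetter_of_mul (by simp [h])]
  | neg v h => rw [firstLetter_of_mul (by simp [h])]; simp [h1]
  | succ_pos v h h' h'' => rw [firstLetter_of_mul h]; simp [h1, h2]
  | succ_neg w h => rcases h with h | h | h <;> simp [h, h1, h2]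
  | other m b w h h' e => rw [e]

/-! ### The braid action on free group colors -/

open ColorSystem

/-- Elements of a group, together with their subdivisions, colored by conjugation. -/
def conjColor (H : Type*) [Group H] : ColorSystem (H × (List Bool → H)) where
  br r :=
    { toFun t := (r.1 * t.1 * r.1⁻¹, fun s => r.1 * t.2 s * r.1⁻¹)
      invFun t := (r.1⁻¹ * t.1 * r.1, fun s => r.1⁻¹ * t.2 s * r.1)
      left_inv t := by simp [mul_assoc]
      right_inv t := by simp [mul_assoc] }
  -- A product forgets its factors, so the second component stores the left factor at `[]` and the
  -- earlier records on the two branches; this makes the operation bijective.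
  op :=
    { toFun p := (p.1.1 * p.2.1, fun s => match s with
        | [] => p.1.1
        | false :: s => p.1.2 s
        | true :: s => p.2.2 s)
      invFun q := ((q.2 [], fun s => q.2 (false :: s)), ((q.2 [])⁻¹ * q.1, fun s => q.2 (true :: s)))
      left_inv p := by simp
      right_inv q := by
        refine Prod.ext (by simp) ?_
        funext s
        match s with | [] | false :: s | true :: s => rfl }
  br_br r t u := by
    refine Prod.ext ?_ ?_
    · simp [mul_assoc]
    · funext s
      simp [mul_assoc]
  br_op r t u := by
    refine Prod.ext ?_ ?_
    · simp [mul_assoc]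
    · funext s
      match s with | [] | false :: s | true :: s => rfl
  op_br r t u := by
    refine Prod.ext ?_ ?_
    · simp [mul_assoc]
    · funext s
      simp [mul_assoc]

/-- The conjugation colors of the free group. -/
abbrev freeColor := conjColor (FreeGroup ℕ)

/-- The sequence of the generators of the free group. -/
def freeSeq (n : ℕ) : FreeGroup ℕ × (List Bool → FreeGroup ℕ) := (.of n, fun _ => 1)

/-- The map on colors induced by the Artin endomorphism. -/
def artinColor (k : ℕ) (r : FreeGroup ℕ × (List Bool → FreeGroup ℕ)) :
    FreeGroup ℕ × (List Bool → FreeGroup ℕ) := (artin k r.1, fun s => artin k (r.2 s))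

theorem ColorSystem.act_σ {R : Type*} (C : ColorSystem R) (s : ℕ → R) (k : ℕ) :
    C.act s (σ k) = fun n =>
      if n = k then C.br (s k) (s (k + 1)) else if n = k + 1 then s k else s n := by
  induction k generalizing s with
  | zero =>
    rw [act_σ_zero]
    funext n
    match n with | 0 | 1 | n + 2 => simp
  | succ k ih =>
    rw [← shift_σ, act_shift, ih]
    funext n
    cases n <;> simp

theorem act_freeSeq_σ (k : ℕ) : freeColor.act freeSeq (σ k) = artinColor k ∘ freeSeq := by
  rw [act_σ]
  funext n
  simp only [Function.comp_apply, artinColor, freeSeq, map_one]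
  split_ifs with h1 h2
  · subst h1
    rw [artin_self]
    simp [conjColor, mul_assoc]
  · subst h2
    rw [artin_succ]
  · rw [artin_of_ne h1 h2]

/-- `σ k` acts first and relabels the generators by the Artin endomorphism, which commutes with
conjugation and hence with the action of `γ`. -/
theorem act_freeSeq_σ_mul (k : ℕ) {γ : Braid} (hγ : γ ∈ braidSubgroup) :
    freeColor.act freeSeq (σ k * γ) = artinColor k ∘ freeColor.act freeSeq γ := by
  rw [act_mul, act_freeSeq_σ, act_map _ _ _ hγ]
  intro r t
  simp [artinColor, conjColor]

/-- The braid moves the strand `k` positively. -/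
def MovesUp (k : ℕ) (γ : Braid) : Prop :=
  firstLetter (freeColor.act freeSeq γ k).1⁻¹ = some (k, true)

theorem MovesUp.σ_mul_self {k : ℕ} {γ : Braid} (hγ : γ ∈ braidSubgroup) (h : MovesUp k γ) :
    MovesUp k (σ k * γ) := by
  rw [MovesUp, act_freeSeq_σ_mul _ hγ, Function.comp_apply, artinColor, ← map_inv]
  exact firstLetter_artin_self h

theorem movesUp_σ_mul {k j : ℕ} (hj : k < j) {γ : Braid} (hγ : γ ∈ braidSubgroup) :
    MovesUp k (σ j * γ) ↔ MovesUp k γ := by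
  rw [MovesUp, act_freeSeq_σ_mul _ hγ, Function.comp_apply, artinColor, ← map_inv,
    firstLetter_artin_iff hj, MovesUp]

theorem iterate_shift_σ (k i : ℕ) : shift^[k] (σ i) = σ (i + k) := by
  induction k generalizing i with
  | zero => rfl
  | succ k ih => rw [Function.iterate_succ_apply, shift_σ, ih, add_assoc, add_comm 1]

theorem iterate_shift_mem {x : Braid} (hx : x ∈ braidSubgroup) (k : ℕ) :
    shift^[k] x ∈ braidSubgroup := by
  induction k with
  | zero => exact hx
  | succ k ih =>
    rw [Function.iterate_succ_apply']
    exact shift_mem_braidSubgroup ih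

theorem MovesUp.shift_mul {k : ℕ} {u γ : Braid} (hu : u ∈ braidSubgroup)
    (hγ : γ ∈ braidSubgroup) (h : MovesUp k γ) : MovesUp k (shift^[k + 1] u * γ) := by
  induction hu using Subgroup.closure_induction_left with
  | one => simpa using h
  | mul_left x hx y hy ih =>
    obtain ⟨i, rfl⟩ := hx
    rw [iterate_map_mul, iterate_shift_σ, mul_assoc,
      movesUp_σ_mul (by omega) (mul_mem (iterate_shift_mem hy _) hγ)]
    exact ih
  | inv_mul_cancel x hx y hy ih =>
    obtain ⟨i, rfl⟩ := hx
    rw [iterate_map_mul, iterate_map_inv, iterate_shift_σ, mul_assoc,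
      ← movesUp_σ_mul (j := i + (k + 1)) (by omega)
        (mul_mem (inv_mem (σ_mem_braidSubgroup _)) (mul_mem (iterate_shift_mem hy _) hγ)),
      mul_inv_cancel_left]
    exact ih

theorem ColorSystem.act_iterate_shift {R : Type*} (C : ColorSystem R) {m n : ℕ} (h : n < m)
    (s : ℕ → R) (u : Braid) : C.act s (shift^[m] u) n = s n := by
  induction m generalizing n s with
  | zero => omega
  | succ m ih =>
    rw [Function.iterate_succ_apply', act_shift]
    cases n with
    | zero => rfl
    | succ n => rw [cons_succ, ih (by omega), tail_apply]

theorem movesUp_σ_mul_shift (k : ℕ) {u : Braid} (hu : u ∈ braidSubgroup) :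
    MovesUp k (σ k * shift^[k + 1] u) := by
  rw [MovesUp, act_freeSeq_σ_mul _ (iterate_shift_mem hu _), Function.comp_apply,
    act_iterate_shift _ (Nat.lt_succ_self k), artinColor, freeSeq]
  simp only [artin_self, mul_inv_rev, inv_inv, mul_assoc]
  refine firstLetter_of_mul ?_
  rw [firstLetter_inv_mul]
  · simp
  · have : firstLetter (.of k)⁻¹ = some (k, false) := by
      simpa using firstLetter_inv_mul (n := k) (g := 1) (by simp [firstLetter_one])
    simp [this]

theorem IsSigmaPositive.mem_braidSubgroup {x : Braid} (hx : IsSigmaPositive x) :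
    x ∈ braidSubgroup := by
  induction hx with
  | base hu hv =>
    exact mul_mem (mul_mem (shift_mem_braidSubgroup hu) (σ_mem_braidSubgroup 0))
      (shift_mem_braidSubgroup hv)
  | mul _ _ ihx ihy => exact mul_mem ihx ihy

/-- The word is read from the right, `δ` being the part already read. The first `σ k` met creates
the leading `x_k`; later ones and shifted factors preserve it. -/
theorem IsSigmaPositive.movesUp {x : Braid} (hx : IsSigmaPositive x) (k : ℕ) {δ : Braid}
    (hδ : δ ∈ braidSubgroup)
    (h : MovesUp k δ ∨ ∃ u ∈ braidSubgroup, δ = shift^[k + 1] u) :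
    MovesUp k (shift^[k] x * δ) := by
  induction hx generalizing δ with
  | @base u v hu hv =>
    have e : shift^[k] (shift u * σ 0 * shift v) * δ =
        shift^[k + 1] u * (σ k * (shift^[k + 1] v * δ)) := by
      rw [iterate_map_mul, iterate_map_mul, iterate_shift_σ, zero_add]
      simp only [Function.iterate_succ_apply, mul_assoc]
    rw [e]
    refine .shift_mul hu (mul_mem (σ_mem_braidSubgroup k)
      (mul_mem (iterate_shift_mem hv _) hδ)) ?_
    rcases h with h | ⟨w, hw, rfl⟩
    · exact (h.shift_mul hv hδ).σ_mul_self (mul_mem (iterate_shift_mem hv _) hδ)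
    · rw [← iterate_map_mul]
      exact movesUp_σ_mul_shift k (mul_mem hv hw)
  | mul hx hy ihx ihy =>
    rw [iterate_map_mul, mul_assoc]
    exact ihx (mul_mem (iterate_shift_mem hy.mem_braidSubgroup _) hδ) (.inl (ihy hδ h))

theorem IsSigmaPositive.shift_ne {x : Braid} (hx : IsSigmaPositive x) (k : ℕ) {u : Braid} :
    shift^[k] x ≠ shift^[k + 1] u := by
  intro e
  -- A `(k + 1)`-fold shift leaves color `k` equal to `x_k`, whose inverse begins with `x_k⁻¹`.
  have h := hx.movesUp k (one_mem _) (.inr ⟨1, one_mem _, (iterate_map_one shift _).symm⟩)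
  rw [mul_one, e, MovesUp, act_iterate_shift _ (Nat.lt_succ_self k), freeSeq] at h
  have : firstLetter (.of k)⁻¹ = some (k, false) := by
    simpa using firstLetter_inv_mul (n := k) (g := 1) (by simp [firstLetter_one])
  simp [this] at h

theorem IsSpecialBraid.eq_of_shift {y z : Braid} (hy : IsSpecialBraid y) (hz : IsSpecialBraid z)
    {k : ℕ} {u : Braid} (h : shift^[k] (y⁻¹ * z) = shift^[k + 1] u) : y = z := by
  rcases hy.comparison hz with e | h' | h'
  · exact e
  · exact absurd h (h'.shift_ne k)
  · refine absurd ?_ (h'.shift_ne k (u := u⁻¹))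
    rw [iterate_map_inv, ← h, ← iterate_map_inv, mul_inv_rev, inv_inv]

/-- Cancelling the first entries leaves an equality of shifted tails. The exponent `k` lets the
induction continue under the shift, with no appeal to its injectivity. -/
theorem braid_unique {l l' : List Braid} (hl : ∀ z ∈ l, IsSpecialBraid z)
    (hl' : ∀ z ∈ l', IsSpecialBraid z) (hlen : l.length = l'.length) (k : ℕ)
    (e : shift^[k] (shiftedProd l) = shift^[k] (shiftedProd l')) : l = l' := by
  induction l generalizing l' k with
  | nil => exact (List.length_eq_zero_iff.1 hlen.symm).symm
  | cons y l ih =>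
    cases l' with
    | nil => simp at hlen
    | cons z l' =>
      rw [shiftedProd_cons, shiftedProd_cons, iterate_map_mul, iterate_map_mul,
        ← Function.iterate_succ_apply, ← Function.iterate_succ_apply] at e
      have : y = z := by
        refine (hl y (by simp)).eq_of_shift (hl' z (by simp)) (k := k)
          (u := shiftedProd l * (shiftedProd l')⁻¹) ?_
        rw [iterate_map_mul, iterate_map_inv, iterate_map_mul, iterate_map_inv, inv_mul_eq_iff_eq_mul,
          ← mul_assoc, e, mul_inv_cancel_right]
      subst this
      rw [ih (fun z hz => hl z (by simp [hz])) (fun z hz => hl' z (by simp [hz]))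
        (by simpa using hlen) (k + 1) (mul_left_cancel e)]

/-! ### Uniqueness of the decompositions -/

/-- The shapes come first: once they agree they cancel, and they force the two leaf lists to have
equal length, as `braid_unique` demands. -/
theorem special_unique {l l' : List Braid} (hl : ∀ z ∈ l, IsSpecial z)
    (hl' : ∀ z ∈ l', IsSpecial z) (hlen : l.length = l'.length)
    (e : shiftedProd l = shiftedProd l') : l = l' := by
  have key : ∀ l : List Braid, (∀ z ∈ l, IsSpecial z) → ∃ m : List (Tree Braid),
      m.map Tree.eval = l ∧ ∀ x ∈ m.flatMap Tree.leaves, IsSpecialBraid x := by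
    intro l hl
    induction l with
    | nil => exact ⟨[], rfl, by simp⟩
    | cons z l ih =>
      obtain ⟨m, rfl, hm⟩ := ih fun z hz => hl z (by simp [hz])
      obtain ⟨t, ht, rfl⟩ := (hl z (by simp)).exists_tree
      refine ⟨t :: m, rfl, fun x hx => ?_⟩
      rcases List.mem_append.1 (List.flatMap_cons ▸ hx) with h | h
      · exact ht x h
      · exact hm x h
  obtain ⟨m, rfl, hm⟩ := key l hl
  obtain ⟨m', rfl, hm'⟩ := key l' hl'
  rw [Tree.shiftedProd_map_eval, Tree.shiftedProd_map_eval] at e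
  have hs : m.map Tree.skeleton = m'.map Tree.skeleton :=
    shape_unique (shiftedProd_mem_braidSubgroup fun z hz => (hm z hz).mem_braidSubgroup)
      (shiftedProd_mem_braidSubgroup fun z hz => (hm' z hz).mem_braidSubgroup)
      (by simpa using hlen) e
  rw [hs] at e
  have := braid_unique hm hm' (Tree.length_flatMap_leaves hs) 0 (mul_right_cancel e)
  rw [Tree.eq_of_skeleton_eq hs this]

theorem exists_map_shape {l : List Braid} (hl : ∀ z ∈ l, IsSpecialThompson z) :
    ∃ m : List (Tree Unit), m.map Tree.shape = l := by
  induction l with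
  | nil => exact ⟨[], rfl⟩
  | cons z l ih =>
    obtain ⟨m, rfl⟩ := ih fun z hz => hl z (by simp [hz])
    obtain ⟨t, rfl⟩ := (hl z (by simp)).exists_tree
    exact ⟨t :: m, rfl⟩

theorem braid_thompson_unique {b b' h h' : List Braid} (hb : ∀ z ∈ b, IsSpecialBraid z)
    (hb' : ∀ z ∈ b', IsSpecialBraid z) (hh : ∀ z ∈ h, IsSpecialThompson z)
    (hh' : ∀ z ∈ h', IsSpecialThompson z) (hlb : b.length = b'.length)
    (hlh : h.length = h'.length)
    (e : shiftedProd b * shiftedProd h = shiftedProd b' * shiftedProd h') : b = b' ∧ h = h' := by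
  obtain ⟨m, rfl⟩ := exists_map_shape hh
  obtain ⟨m', rfl⟩ := exists_map_shape hh'
  obtain rfl : m = m' :=
    shape_unique (shiftedProd_mem_braidSubgroup fun z hz => (hb z hz).mem_braidSubgroup)
      (shiftedProd_mem_braidSubgroup fun z hz => (hb' z hz).mem_braidSubgroup)
      (by simpa using hlh) e
  exact ⟨braid_unique hb hb' hlb 0 (mul_right_cancel e), rfl⟩

/-! ### Trailing trivial entries -/

section Padding

variable {α : Type*} {d : α}

theorem exists_eq_append_replicate (d : α) (l : List α) :
    ∃ m n, l = m ++ List.replicate n d ∧ m.getLast? ≠ some d := by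
  induction l using List.reverseRecOn with
  | nil => exact ⟨[], 0, rfl, by simp⟩
  | append_singleton l x ih =>
    by_cases h : x = d
    · obtain ⟨m, n, rfl, hm⟩ := ih
      exact ⟨m, n + 1, by rw [h, List.append_assoc, ← List.replicate_succ'], hm⟩
    · exact ⟨l ++ [x], 0, by simp, by simpa using h⟩

theorem eq_of_append_replicate {l l' : List α} (hl : l.getLast? ≠ some d)
    (hl' : l'.getLast? ≠ some d) {m n : ℕ}
    (e : l ++ List.replicate m d = l' ++ List.replicate n d) : l = l' := by
  induction m generalizing n with
  | zero =>
    cases n with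
    | zero => simpa using e
    | succ n =>
      refine absurd ?_ hl
      rw [List.replicate_zero, List.append_nil, List.replicate_succ', ← List.append_assoc] at e
      simp [e]
  | succ m ih =>
    cases n with
    | zero =>
      refine absurd ?_ hl'
      rw [List.replicate_zero, List.append_nil, List.replicate_succ', ← List.append_assoc] at e
      simp [← e]
    | succ n =>
      rw [List.replicate_succ', List.replicate_succ', ← List.append_assoc, ← List.append_assoc] at e
      exact ih (List.append_inj_left' e rfl)

theorem existsUnique_trimmed {G : Type*} {p : α → Prop} (hd : p d) (f : List α → G)
    (hf : ∀ l n, f (l ++ List.replicate n d) = f l)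
    (inj : ∀ l l' : List α, (∀ z ∈ l, p z) → (∀ z ∈ l', p z) → l.length = l'.length →
      f l = f l' → l = l') {x : G} (hx : ∃ l, (∀ z ∈ l, p z) ∧ x = f l) :
    ∃! l : List α, (∀ z ∈ l, p z) ∧ l.getLast? ≠ some d ∧ x = f l := by
  obtain ⟨l, hl, rfl⟩ := hx
  obtain ⟨m, n, rfl, hm⟩ := exists_eq_append_replicate d l
  have pad : ∀ (l : List α) (n : ℕ), (∀ z ∈ l, p z) → ∀ z ∈ l ++ List.replicate n d, p z := by
    intro l n hl z hz
    rcases List.mem_append.1 hz with h | h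
    · exact hl z h
    · rwa [List.eq_of_mem_replicate h]
  have hm' : ∀ z ∈ m, p z := fun z hz => hl z (List.mem_append_left _ hz)
  refine ⟨m, ⟨hm', hm, hf m n⟩, ?_⟩
  rintro l' ⟨h1, h2, h3⟩
  -- Padding each list by the length of the other equalizes the lengths.
  refine eq_of_append_replicate h2 hm (m := m.length) (n := l'.length)
    (inj _ _ (pad _ _ h1) (pad _ _ hm') (by simp [add_comm]) ?_)
  rw [hf, hf, ← h3, hf]

end Padding

/-! ### Matching lengths of lists, and the final assembly -/

theorem exists_pair_list {b h : List Braid} (hb : ∀ z ∈ b, IsSpecialBraid z)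
    (hh : ∀ z ∈ h, IsSpecialThompson z) : ∃ l : List (Braid × Braid),
      (∀ d ∈ l, IsSpecialBraid d.1 ∧ IsSpecialThompson d.2) ∧
      shiftedProd (l.map Prod.fst) = shiftedProd b ∧
      shiftedProd (l.map Prod.snd) = shiftedProd h := by
  induction b generalizing h with
  | nil =>
    refine ⟨h.map fun z => (1, z), by simpa using fun z hz => ⟨.one, hh z hz⟩, ?_, ?_⟩
    · simpa [Function.comp_def] using shiftedProd_replicate h.length
    · simp [Function.comp_def]
  | cons x b ih =>
    have hb' : ∀ z ∈ b, IsSpecialBraid z := fun z hz => hb z (by simp [hz])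
    cases h with
    | nil =>
      obtain ⟨l, h1, h2, h3⟩ := ih hb' hh
      exact ⟨(x, 1) :: l, by simpa using ⟨⟨hb x (by simp), .one⟩, by simpa using h1⟩,
        by simp [h2], by simp [h3]⟩
    | cons y h =>
      obtain ⟨l, h1, h2, h3⟩ := ih (h := h) hb' fun z hz => hh z (by simp [hz])
      exact ⟨(x, y) :: l, by
        simpa using ⟨⟨hb x (by simp), hh y (by simp)⟩, by simpa using h1⟩,
        by simp [h2], by simp [h3]⟩

theorem exists_padded {p : Braid → Prop} (h1 : p 1) {l : List Braid} (hl : ∀ z ∈ l, p z) {n : ℕ}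
    (hn : l.length ≤ n) :
    ∃ m : List Braid, m.length = n ∧ (∀ z ∈ m, p z) ∧ shiftedProd m = shiftedProd l := by
  refine ⟨l ++ List.replicate (n - l.length) 1, by simp [hn], fun z hz => ?_,
    shiftedProd_append_replicate _ _⟩
  rcases List.mem_append.1 hz with h | h
  · exact hl z h
  · rwa [List.eq_of_mem_replicate h]

theorem IsSpecialThompson.isSpecial {z : Braid} (hz : IsSpecialThompson z) : IsSpecial z := by
  induction hz with
  | one => exact .one
  | circ _ _ hx hy => exact .circ hx hy

end ParenBraid

open ParenBraid in
theorem proposition3p21 :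
    (∀ x ∈ positive, ∃! l : List Braid,
      (∀ z ∈ l, IsSpecial z) ∧ l.getLast? ≠ some 1 ∧ x = shiftedProd l) ∧
    (∀ x ∈ positive, ∃! l : List (Braid × Braid),
      (∀ d ∈ l, IsSpecialBraid d.1 ∧ IsSpecialThompson d.2) ∧ l.getLast? ≠ some (1, 1) ∧
        x = shiftedProd (l.map Prod.fst) * shiftedProd (l.map Prod.snd)) ∧
    (∀ f ∈ positiveThompson, ∃! l : List Braid,
      (∀ h ∈ l, IsSpecialThompson h) ∧ l.getLast? ≠ some 1 ∧ f = shiftedProd l) ∧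
    (∀ x : Braid, ∃ l' l : List Braid, (∀ z ∈ l', IsSpecial z) ∧ (∀ z ∈ l, IsSpecial z) ∧
      x = (shiftedProd l')⁻¹ * shiftedProd l) ∧
    (∀ x : Braid, ∃ (n : ℕ) (h' β' β h : List Braid),
      (h'.length = n ∧ β'.length = n ∧ β.length = n ∧ h.length = n) ∧
      (∀ y ∈ h', IsSpecialThompson y) ∧ (∀ y ∈ β', IsSpecialBraid y) ∧
      (∀ y ∈ β, IsSpecialBraid y) ∧ (∀ y ∈ h, IsSpecialThompson y) ∧
      x = (shiftedProd h')⁻¹ * (shiftedProd β')⁻¹ * shiftedProd β * shiftedProd h) := by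
  refine ⟨fun x hx => ?_, fun x hx => ?_, fun f hf => ?_, fun x => ?_, fun x => ?_⟩
  · exact existsUnique_trimmed .one shiftedProd shiftedProd_append_replicate
      (fun _ _ => special_unique) (exists_shiftedProd_of_mem_positive hx)
  · refine existsUnique_trimmed (d := ((1, 1) : Braid × Braid))
      (p := fun d => IsSpecialBraid d.1 ∧ IsSpecialThompson d.2) ⟨.one, .one⟩
      (fun l => shiftedProd (l.map Prod.fst) * shiftedProd (l.map Prod.snd))
      (fun l n => by simp [shiftedProd_append_replicate]) (fun l l' hl hl' hlen e => ?_) ?_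
    · have := braid_thompson_unique (by simpa using fun y w h => (hl (y, w) h).1)
        (by simpa using fun y w h => (hl' (y, w) h).1)
        (by simpa using fun y w h => (hl (w, y) h).2)
        (by simpa using fun y w h => (hl' (w, y) h).2) (by simpa using hlen)
        (by simpa using hlen) e
      -- A list of pairs is determined by its two projections.
      rw [← List.zip_unzip l, ← List.zip_unzip l', List.unzip_eq_map, List.unzip_eq_map]
      simp [this.1, this.2]
    · obtain ⟨w, hw, h, hh, rfl⟩ := exists_mul_of_mem_positive hx
      obtain ⟨b, hb, rfl⟩ := exists_shiftedProd_of_mem_positiveBraid hw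
      obtain ⟨t, ht, rfl⟩ := exists_shiftedProd_of_mem_positiveThompson hh
      obtain ⟨l, hl, e1, e2⟩ := exists_pair_list hb ht
      exact ⟨l, hl, by rw [e1, e2]⟩
  · exact existsUnique_trimmed .one shiftedProd shiftedProd_append_replicate
      (fun _ _ hl hl' => special_unique (fun z hz => (hl z hz).isSpecial)
        fun z hz => (hl' z hz).isSpecial) (exists_shiftedProd_of_mem_positiveThompson hf)
  · obtain ⟨h', hh', γ, hγ, h, hh, rfl⟩ := exists_thompson_fraction x
    obtain ⟨c, hc, d, hd, rfl⟩ := exists_fraction_of_mem_braidSubgroup hγ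
    obtain ⟨l', hl', e'⟩ := exists_shiftedProd_of_mem_positive
      (mul_mem (positiveBraid_le hc) (positiveThompson_le hh'))
    obtain ⟨l, hl, e⟩ := exists_shiftedProd_of_mem_positive
      (mul_mem (positiveBraid_le hd) (positiveThompson_le hh))
    refine ⟨l', l, hl', hl, ?_⟩
    rw [← e, ← e']
    group
  · obtain ⟨h', hh', γ, hγ, h, hh, rfl⟩ := exists_thompson_fraction x
    obtain ⟨c, hc, d, hd, rfl⟩ := exists_fraction_of_mem_braidSubgroup hγ
    obtain ⟨l₁, hl₁, rfl⟩ := exists_shiftedProd_of_mem_positiveThompson hh'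
    obtain ⟨l₂, hl₂, rfl⟩ := exists_shiftedProd_of_mem_positiveBraid hc
    obtain ⟨l₃, hl₃, rfl⟩ := exists_shiftedProd_of_mem_positiveBraid hd
    obtain ⟨l₄, hl₄, rfl⟩ := exists_shiftedProd_of_mem_positiveThompson hh
    -- Any common upper bound for the four lengths would do; the sum is convenient.
    obtain ⟨n, hn⟩ : ∃ n, n = l₁.length + l₂.length + l₃.length + l₄.length := ⟨_, rfl⟩
    obtain ⟨m₁, n₁, h₁, e₁⟩ := exists_padded .one hl₁ (n := n) (by omega)
    obtain ⟨m₂, n₂, h₂, e₂⟩ := exists_padded .one hl₂ (n := n) (by omega)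
    obtain ⟨m₃, n₃, h₃, e₃⟩ := exists_padded .one hl₃ (n := n) (by omega)
    obtain ⟨m₄, n₄, h₄, e₄⟩ := exists_padded .one hl₄ (n := n) (by omega)
    refine ⟨n, m₁, m₂, m₃, m₄, ⟨n₁, n₂, n₃, n₄⟩, h₁, h₂, h₃, h₄, ?_⟩
    rw [e₁, e₂, e₃, e₄]
    group
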